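/- Notation: $e(\theta)=e^{2\pi i\theta}$, and $y\sim Y$ means that $y$ is an integer with $Y<y\le 2Y$. There is an absolute constant $\varepsilon_0>0$ such that for every $0<\varepsilon<\varepsilon_0$ and every $A>0$ there is a constant $C=C(\varepsilon,A)>0$ with the following property. Put $\eta=\varepsilon^9$. Let $\frac16<\rho<\frac2{11}$, let $a/q$ be a fraction in lowest terms ($a\in\mathbb Z$, $q\ge1$), let $\beta,\gamma$ be real and let $$g(x)=\frac aq\,x^2+\beta x+\gamma .$$ Let $N\ge 1$ be a real number, put $L_1=2N^{\rho-\varepsilon/2}$ and $L=N^{\rho-\varepsilon/3}$, and suppose that $$A^{-1}L_1^{1/2}N\le q\le A\,L_1^{1/2}N .$$ Let $V\ge1$ and $W\ge1$ be real numbers with $$V^3W^2\le A\,N^{2-3\rho},\qquad VW^3\le A\,N^{3-15\rho/2},\qquad VW\le A\,N^{2-8\rho}.$$ For each positive integer $m$ let $I(m)$ be an arbitrary subinterval of $\left(\frac N{2m},\frac Nm\right]$. Then $$\sum_{1\le\ell\le L}\ \sum_{v\sim V}\ \sum_{w\sim W}\ \Bigl|\sum_{n\in I(vw)}e\bigl(\ell\,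 g(vwn)\bigr)\Bigr|\le C\,N^{1-10\eta}.$$ -/

import Mathlib

namespace TypeI

/-- `e(θ) = exp(2πiθ)`. -/
noncomputable def e (θ : ℝ) : ℂ := Complex.exp (2 * Real.pi * Complex.I * θ)

/-- The quadratic polynomial `g(x) = (a/q) x² + β x + γ`. -/
noncomputable def g (a : ℤ) (q : ℕ) (β γ : ℝ) (x : ℝ) : ℝ :=
  (a : ℝ) / (q : ℝ) * x ^ 2 + β * x + γ

/-- The positive integers `y` with `y ∼ Y`, that is, `Y < y ≤ 2Y`. -/
noncomputable def dyadic (Y : ℝ) : Finset ℕ := Finset.Ioc ⌊Y⌋₊ ⌊2 * Y⌋₊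

theorem mem_dyadic {Y : ℝ} (hY : 0 ≤ Y) (y : ℕ) :
    y ∈ dyadic Y ↔ Y < (y : ℝ) ∧ (y : ℝ) ≤ 2 * Y := by
  rw [dyadic, Finset.mem_Ioc, Nat.floor_lt hY, Nat.le_floor_iff (by positivity)]

/-- `I` assigns to every positive integer `m` a subinterval `I(m)` of `(N/(2m), N/m]`
(of any kind, possibly empty). -/
def IsSubintervalFamily (N : ℝ) (I : ℕ → Set ℝ) : Prop :=
  ∀ m : ℕ, 0 < m → (I m).OrdConnected ∧ I m ⊆ Set.Ioc (N / (2 * (m : ℝ))) (N / (m : ℝ))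

open Classical in
/-- The integers `n` in `I(m)`, for a family of subintervals of `(N/(2m), N/m]`. -/
noncomputable def integersIn (N : ℝ) (I : ℕ → Set ℝ) (m : ℕ) : Finset ℕ :=
  (Finset.Icc 1 ⌊N / (m : ℝ)⌋₊).filter (fun n : ℕ => (n : ℝ) ∈ I m)

theorem mem_integersIn {N : ℝ} (hN : 0 ≤ N) {I : ℕ → Set ℝ} (hI : IsSubintervalFamily N I)
    {m : ℕ} (hm : 0 < m) (n : ℕ) : n ∈ integersIn N I m ↔ (n : ℝ) ∈ I m := by
  classical
  simp only [integersIn, Finset.mem_filter, Finset.mem_Icc]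
  refine ⟨fun h => h.2, fun h => ⟨⟨?_, ?_⟩, h⟩⟩
  · have h1 : (0 : ℝ) < n := lt_of_le_of_lt (by positivity) ((hI m hm).2 h).1
    exact_mod_cast h1
  · exact Nat.le_floor ((hI m hm).2 h).2

/-- `T = ∑_{1 ≤ ℓ ≤ L} ∑_{v ∼ V} ∑_{w ∼ W} |∑_{n ∈ I(vw)} e(ℓ g(vwn))|`. -/
noncomputable def T (a : ℤ) (q : ℕ) (β γ N L V W : ℝ) (I : ℕ → Set ℝ) : ℝ :=
  ∑ l ∈ Finset.Icc 1 ⌊L⌋₊, ∑ v ∈ dyadic V, ∑ w ∈ dyadic W,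
    ‖∑ n ∈ integersIn N I (v * w),
      e ((l : ℝ) * g a q β γ ((v : ℝ) * (w : ℝ) * (n : ℝ)))‖

end TypeI

namespace TypeI

/-! Put $m=vw$, $H=N/(VW)$ and $P=N^\eta$; constants, logarithms and divisor functions cost at most
$P$.

Cauchy–Schwarz over $\ell$ and Weyl differencing reduce the inner sums for one $m$ to sums of
$\min(H,1/\|k\,m^2a/q\|)$ over $k=2\ell h\le 2LH$, where the divisor bound pays for the repetition
of $k$. If $u/t$ is a Dirichlet approximation to $m^2a/q$ and $Y_m=\max(t,\,|t\,m^2a/q-u|\,LH^2)$,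
the sum over $\ell$ for this $m$ is at most about $L\sqrt H+LH/\sqrt{Y_m}$ (`sum_normSq_le`). The
first term is acceptable because $L^2VW$ is smaller than $N$ by a power of $P$. The second is
acceptable once the pairs $(v,w)$ with $Y_m\le y$ number at most $VW\sqrt y/(LP^{15})$ for $y\le
2L^2P^{30}$, since a larger $Y_m$ is harmless pointwise.

For that count, fix $w$ (`card_slice_le`). The numbers $t v^2$ are integers at which $w^2a/q$ is
nearly integral. Either they are few, by the spacing of the multiples of a reduced fraction, or all
the fractions $u/(tv^2)$ coincide; then up to a divisor function $t$ is constant, and $v^2$ is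
divisible by a fixed $e$, which saves $\sqrt e$ in the number of $v$. In the second case $w^2a/q$
itself has a good approximation with denominator $k(w)\le ye$. The $w$ with $e\le y'$ are counted by
pairing those with equal $k$ (`card_sq_le_of_near_int`): $k(w_2^2-w_1^2)a/q$ is near an integer, the
integer $k(w_2^2-w_1^2)$ has few such representations, and the multiples of $a/q$ are well spaced.
Summing $1/\sqrt e$ over $w$ gives `card_good_approx_le`. The conditions on $V$, $W$, $q$ and $\rho$
are what makes each resulting term small. -/

/-! ### Counting tools: spacing of fractions, dyadic summation, divisor bound -/

/-- A bounded-to-one map bounds a sum of nonnegative terms. -/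
theorem sum_comp_le_mul_sum {ι κ : Type*} [DecidableEq κ] {s : Finset ι} {t : Finset κ}
    {f : ι → κ} (hf : ∀ x ∈ s, f x ∈ t) {B : κ → ℝ} (hB : ∀ y ∈ t, 0 ≤ B y) {τ : ℝ}
    (hτ : ∀ y ∈ t, ((s.filter (fun x => f x = y)).card : ℝ) ≤ τ) :
    ∑ x ∈ s, B (f x) ≤ τ * ∑ y ∈ t, B y := by
  rw [← Finset.sum_fiberwise_of_maps_to hf, Finset.mul_sum]
  refine Finset.sum_le_sum fun y hy => ?_
  rw [Finset.sum_congr rfl (g := fun _ => B y)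
    (fun x hx => by rw [(Finset.mem_filter.1 hx).2]), Finset.sum_const, nsmul_eq_mul]
  exact mul_le_mul_of_nonneg_right (hτ y hy) (hB y hy)

theorem card_le_mul_card {ι κ : Type*} [DecidableEq κ] {s : Finset ι} {t : Finset κ}
    {f : ι → κ} (hf : ∀ x ∈ s, f x ∈ t) {τ : ℝ}
    (hτ : ∀ y ∈ t, ((s.filter (fun x => f x = y)).card : ℝ) ≤ τ) :
    (s.card : ℝ) ≤ τ * t.card := by
  simpa using sum_comp_le_mul_sum hf (B := fun _ => 1) (fun _ _ => zero_le_one) hτ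

/-- The number of `k ≤ K` for which `k u / t` is within `δ` of an integer. -/
theorem card_near_int_le {u : ℤ} {t : ℕ} (ht : 0 < t) (hut : IsCoprime u (t : ℤ)) {δ : ℝ}
    (hδ : 0 ≤ δ) (K : ℕ) {s : Finset ℕ} (hs : ∀ k ∈ s, 1 ≤ k ∧ k ≤ K)
    (hz : ∀ k ∈ s, ∃ z : ℤ, |(k : ℝ) * ((u : ℝ) / t) - z| ≤ δ) :
    (s.card : ℝ) ≤ ((K : ℝ) / t + 1) * (2 * t * δ + 1) := by
  choose! z hz using hz
  have ht' : (0 : ℝ) < t := by exact_mod_cast ht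
  set c : ℕ → ℤ := fun k => k * u - z k * t with hc
  set M : ℕ := ⌊(t : ℝ) * δ⌋₊ with hM
  have hcM : ∀ k ∈ s, |c k| ≤ M := by
    intro k hk
    have h1 : ((|c k| : ℤ) : ℝ) ≤ t * δ := by
      have : ((|c k| : ℤ) : ℝ) = t * |(k : ℝ) * ((u : ℝ) / t) - z k| := by
        rw [← abs_of_pos ht', ← abs_mul, abs_of_pos ht']
        push_cast [hc]
        congr 1
        field_simp
      rw [this]
      exact mul_le_mul_of_nonneg_left (hz k hk) ht'.le
    have h2 : (((c k).natAbs : ℕ) : ℝ) ≤ t * δ := by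
      rw [Nat.cast_natAbs]; exact h1
    have h5 : (((c k).natAbs : ℕ) : ℤ) ≤ M := by exact_mod_cast Nat.le_floor h2
    rwa [Int.natCast_natAbs] at h5
  -- Split `1, …, K` into blocks of length `t`. Within a block the residue `c k` of `k * u`
  -- determines `k`, because `u` is invertible modulo `t`.
  have hinj : s.card ≤ (Finset.range (K / t + 1) ×ˢ Finset.Icc (-(M : ℤ)) M).card := by
    refine Finset.card_le_card_of_injOn (fun k => ((k - 1) / t, c k)) ?_ ?_
    · intro k hk
      have hk : k ∈ s := hk
      simp only [Finset.coe_product, Set.mem_prod, Finset.mem_coe, Finset.mem_range,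
        Finset.mem_Icc]
      refine ⟨?_, abs_le.1 (hcM k hk)⟩
      have := Nat.div_le_div_right (c := t) (show k - 1 ≤ K by have := hs k hk; omega)
      omega
    · intro k hk k' hk' h
      have hk : k ∈ s := hk
      have hk' : k' ∈ s := hk'
      simp only [Prod.mk.injEq] at h
      have hd : (t : ℤ) ∣ ((k : ℤ) - k') * u := by
        refine ⟨z k - z k', ?_⟩
        have := h.2
        simp only [hc] at this
        linear_combination this
      have hd' : (t : ℤ) ∣ (k : ℤ) - k' := hut.symm.dvd_of_dvd_mul_right hd
      have hmod : (k - 1) % t = (k' - 1) % t := by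
        have h1 := (hs k hk).1
        have h2 := (hs k' hk').1
        have : (((k - 1 : ℕ) : ℤ)) % t = ((k' - 1 : ℕ) : ℤ) % t := by
          apply Int.emod_emod_of_dvd _ (dvd_refl _) |>.symm.trans ?_ 
          rw [Int.emod_emod_of_dvd _ (dvd_refl _)]
          rw [Int.emod_eq_emod_iff_emod_sub_eq_zero]
          apply Int.emod_eq_zero_of_dvd
          rw [Nat.cast_sub h1, Nat.cast_sub h2]
          simpa using hd'
        exact_mod_cast this
      have e1 := Nat.div_add_mod (k - 1) t
      have e2 := Nat.div_add_mod (k' - 1) t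
      rw [h.1, hmod] at e1
      have h1 := (hs k hk).1
      have h2 := (hs k' hk').1
      omega
  have hcard : (Finset.range (K / t + 1) ×ˢ Finset.Icc (-(M : ℤ)) M).card
      = (K / t + 1) * (2 * M + 1) := by
    rw [Finset.card_product, Finset.card_range, Int.card_Icc]
    congr 1
    omega
  rw [hcard] at hinj
  calc (s.card : ℝ) ≤ (((K / t + 1) * (2 * M + 1) : ℕ) : ℝ) := by exact_mod_cast hinj
    _ = (((K / t : ℕ) : ℝ) + 1) * (2 * M + 1) := by push_cast; ring
    _ ≤ ((K : ℝ) / t + 1) * (2 * t * δ + 1) := by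
      have h1 : ((K / t : ℕ) : ℝ) ≤ (K : ℝ) / t := Nat.cast_div_le
      have h2 : (M : ℝ) ≤ t * δ := Nat.floor_le (by positivity)
      have h3 : 2 * (M : ℝ) + 1 ≤ 2 * t * δ + 1 := by linarith
      gcongr

/-- If the level sets of `f ≥ 1` satisfy `#{f ≤ y} ≤ B √y`, then `∑ 1 / √f` is small. -/
theorem sum_inv_sqrt_le {ι : Type*} (s : Finset ι) (f : ι → ℝ) (hf : ∀ x ∈ s, 1 ≤ f x)
    {B : ℝ} (hB : 0 ≤ B) (J : ℕ) {Y : ℝ} (hY : 0 < Y) (hJ : Y ≤ 2 ^ J)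
    (h : ∀ y : ℝ, 1 ≤ y → y ≤ 2 * Y → ((s.filter (fun x => f x ≤ y)).card : ℝ) ≤ B * √y) :
    ∑ x ∈ s, 1 / √(f x) ≤ s.card / √Y + 2 * J * B := by
  -- Dyadic decomposition: a value below `Y` lies in some $[2^i,2^{i+1})$ with $2^i<Y$, so the
  -- hypothesis is needed only at $y=2^{i+1}\le 2Y$.
  have key : ∀ x ∈ s, 1 / √(f x) ≤ 1 / √Y +
      ∑ i ∈ Finset.range J, if (f x ≤ 2 ^ (i + 1) ∧ (2 : ℝ) ^ i < Y) then 1 / √(2 ^ i) else 0 := by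
    intro x hx
    have hnn : ∀ i ∈ Finset.range J, (0 : ℝ) ≤
        (if (f x ≤ 2 ^ (i + 1) ∧ (2 : ℝ) ^ i < Y) then 1 / √(2 ^ i) else 0) := by
      intro i _
      split_ifs <;> positivity
    by_cases hfx : Y ≤ f x
    · have : 1 / √(f x) ≤ 1 / √Y := by
        apply one_div_le_one_div_of_le (Real.sqrt_pos.2 hY) (Real.sqrt_le_sqrt hfx)
      linarith [Finset.sum_nonneg hnn]
    · push Not at hfx
      obtain ⟨i, hi1, hi2⟩ := exists_nat_pow_near (hf x hx) one_lt_two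
      have hiJ : i < J := by
        have : (2 : ℝ) ^ i < 2 ^ J := by linarith
        exact (pow_lt_pow_iff_right₀ one_lt_two).1 this
      have h1 := Finset.single_le_sum hnn (Finset.mem_range.2 hiJ)
      rw [if_pos ⟨hi2.le, lt_of_le_of_lt hi1 hfx⟩] at h1
      have : 1 / √(f x) ≤ 1 / √(2 ^ i) := by
        apply one_div_le_one_div_of_le (by positivity) (Real.sqrt_le_sqrt hi1)
      have h0 : 0 ≤ 1 / √Y := by positivity
      linarith
  refine (Finset.sum_le_sum key).trans ?_
  rw [Finset.sum_add_distrib, Finset.sum_const, nsmul_eq_mul, Finset.sum_comm, mul_one_div]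
  gcongr
  have : ∀ i ∈ Finset.range J, ∑ x ∈ s,
      (if (f x ≤ 2 ^ (i + 1) ∧ (2 : ℝ) ^ i < Y) then 1 / √(2 ^ i) else 0) ≤ 2 * B := by
    intro i _
    by_cases hi : (2 : ℝ) ^ i < Y
    · simp only [hi, and_true]
      rw [← Finset.sum_filter, Finset.sum_const, nsmul_eq_mul]
      have h1 := h (2 ^ (i + 1)) (one_le_pow₀ one_le_two) (by rw [pow_succ]; linarith)
      have h2 : √((2 : ℝ) ^ (i + 1)) ≤ 2 * √(2 ^ i) := by
        rw [pow_succ, mul_comm, Real.sqrt_mul (by norm_num)]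
        gcongr
        rw [Real.sqrt_le_left (by norm_num)]; norm_num
      have h3 : 0 < √((2 : ℝ) ^ i) := by positivity
      rw [mul_one_div, div_le_iff₀ h3]
      calc _ ≤ B * √(2 ^ (i + 1)) := h1
        _ ≤ B * (2 * √(2 ^ i)) := by gcongr
        _ = _ := by ring
    · simp only [hi, and_false, if_false, Finset.sum_const_zero]
      positivity
  calc _ ≤ ∑ i ∈ Finset.range J, 2 * B := Finset.sum_le_sum this
    _ = _ := by simp; ring

/-- The divisor bound `d(n) ≪ n^δ`. -/
theorem exists_card_divisors_le {δ : ℝ} (hδ : 0 < δ) :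
    ∃ C : ℝ, 0 < C ∧ ∀ n : ℕ, 0 < n → (n.divisors.card : ℝ) ≤ C * (n : ℝ) ^ δ := by
  -- The exponent $k$ of a prime contributes $k+1\le c(1+k\delta\log 2)\le c\,p^{\delta k}$. Primes
  -- $p\ge 2^{1/\delta}$ need no constant, since then $k+1\le 2^k\le p^{\delta k}$; hence at most
  -- `p0` factors `c` occur.
  set c : ℝ := max 1 (1 / (δ * Real.log 2)) with hc
  have hl2 : 0 < Real.log 2 := Real.log_pos one_lt_two
  have hc1 : 1 ≤ c := le_max_left _ _
  have hc2 : 1 ≤ c * (δ * Real.log 2) := by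
    have : 1 / (δ * Real.log 2) ≤ c := le_max_right _ _
    rwa [div_le_iff₀ (by positivity)] at this
  set p0 : ℕ := ⌈(2 : ℝ) ^ (1 / δ)⌉₊ with hp0
  refine ⟨c ^ p0, by positivity, fun n hn => ?_⟩
  have hfac : ∀ p ∈ n.primeFactors, ((n.factorization p : ℝ) + 1) ≤
      (if p < p0 then c else 1) * ((p : ℝ) ^ n.factorization p) ^ δ := by
    intro p hp
    have hp2 : (2 : ℝ) ≤ p := by exact_mod_cast (Nat.prime_of_mem_primeFactors hp).two_le
    set k := n.factorization p
    have hpow : ((p : ℝ) ^ k) ^ δ = ((p : ℝ) ^ δ) ^ k := by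
      rw [← Real.rpow_natCast, ← Real.rpow_mul (by positivity), mul_comm, Real.rpow_mul (by positivity),
        Real.rpow_natCast]
    rw [hpow]
    split_ifs with hlt
    · have h1 : 1 + k * (δ * Real.log 2) ≤ ((p : ℝ) ^ δ) ^ k := by
        have h2 : ((2 : ℝ) ^ δ) ^ k ≤ ((p : ℝ) ^ δ) ^ k := by gcongr
        refine le_trans ?_ h2
        rw [Real.rpow_def_of_pos two_pos, ← Real.exp_nat_mul]
        have := Real.add_one_le_exp ((k : ℝ) * (Real.log 2 * δ))
        linarith
      have hk : (0 : ℝ) ≤ k := by positivity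
      calc (k : ℝ) + 1 ≤ c * (1 + k * (δ * Real.log 2)) := by nlinarith
        _ ≤ _ := by gcongr
    · push Not at hlt
      have h2 : (2 : ℝ) ≤ (p : ℝ) ^ δ := by
        have h3 : (2 : ℝ) ^ (1 / δ) ≤ p := (Nat.le_ceil _).trans (by exact_mod_cast hlt)
        calc (2 : ℝ) = ((2 : ℝ) ^ (1 / δ)) ^ δ := by
              rw [← Real.rpow_mul (by norm_num), one_div_mul_cancel hδ.ne', Real.rpow_one]
          _ ≤ _ := by gcongr
      have h3 : ((k : ℝ) + 1) ≤ 2 ^ k := by exact_mod_cast Nat.lt_two_pow_self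
      rw [one_mul]
      exact h3.trans (by gcongr)
  rw [Nat.card_divisors hn.ne']
  push_cast
  calc ∏ p ∈ n.primeFactors, ((n.factorization p : ℝ) + 1)
      ≤ ∏ p ∈ n.primeFactors, ((if p < p0 then c else 1) * ((p : ℝ) ^ n.factorization p) ^ δ) :=
        Finset.prod_le_prod (fun _ _ => by positivity) hfac
    _ = (∏ p ∈ n.primeFactors, (if p < p0 then c else 1)) * (n : ℝ) ^ δ := by
        rw [Finset.prod_mul_distrib, Real.finsetProd_rpow _ _ (fun _ _ => by positivity)]
        congr 2
        have := Nat.prod_factorization_pow_eq_self hn.ne'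
        conv_rhs => rw [← this]
        rw [Finsupp.prod]
        push_cast
        rfl
    _ ≤ c ^ p0 * (n : ℝ) ^ δ := by
        gcongr
        rw [← Finset.prod_filter, Finset.prod_const]
        apply pow_le_pow_right₀ hc1
        calc _ ≤ (Finset.range p0).card := Finset.card_le_card (fun p hp => by
              simp only [Finset.mem_filter] at hp; simpa using hp.2)
          _ = p0 := by simp


/-! ### Additive characters and Weyl differencing -/

theorem norm_e (x : ℝ) : ‖e x‖ = 1 := by
  have : (2 * Real.pi * Complex.I * x : ℂ) = ((2 * Real.pi * x : ℝ) : ℂ) * Complex.I := by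
    push_cast; ring
  rw [e, this, Complex.norm_exp_ofReal_mul_I]

theorem e_add (x y : ℝ) : e (x + y) = e x * e y := by
  rw [e, e, e, ← Complex.exp_add]; congr 1; push_cast; ring

theorem conj_e (x : ℝ) : (starRingEnd ℂ) (e x) = e (-x) := by
  rw [e, e, ← Complex.exp_conj]; congr 1; simp [map_ofNat]

theorem e_int (n : ℤ) : e n = 1 := by
  rw [e, Complex.exp_eq_one_iff]; exact ⟨n, by push_cast; ring⟩

/-- By periodicity the argument may be taken in $[-\frac12,\frac12]$; there $|e(y)-1|=2|\sin\pi y|$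
and Jordan's inequality applies. -/
theorem four_mul_le_norm_e_sub_one (θ : ℝ) : 4 * |θ - round θ| ≤ ‖e θ - 1‖ := by
  have h1 : e θ = e (θ - round θ) := by
    conv_lhs => rw [show θ = (θ - round θ) + ((round θ : ℤ) : ℝ) by ring, e_add, e_int, mul_one]
  set y := θ - round θ with hy
  have hy2 : |y| ≤ 1 / 2 := abs_sub_round θ
  have h2 : e y = Complex.exp (Complex.I * ((2 * Real.pi * y : ℝ) : ℂ)) := by
    rw [e]; congr 1; push_cast; ring
  rw [h1, h2, Complex.norm_exp_I_mul_ofReal_sub_one, norm_mul, Real.norm_eq_abs, Real.norm_eq_abs,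
    show 2 * Real.pi * y / 2 = Real.pi * y by ring]
  have h3 : |Real.pi * y| ≤ Real.pi / 2 := by
    rw [abs_mul, abs_of_pos Real.pi_pos]; nlinarith [Real.pi_pos]
  have h4 := Real.mul_abs_le_abs_sin h3
  rw [abs_mul Real.pi, abs_of_pos Real.pi_pos] at h4
  have h5 : 2 / Real.pi * (Real.pi * |y|) = 2 * |y| := by
    field_simp
  rw [h5] at h4
  norm_num
  linarith

theorem norm_sum_e_linear_le (θ c : ℝ) (n : ℕ) :
    ‖∑ i ∈ Finset.range n, e (θ * i + c)‖ * (2 * |θ - round θ|) ≤ 1 := by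
  have h1 : ∑ i ∈ Finset.range n, e (θ * i + c) = e c * ∑ i ∈ Finset.range n, e θ ^ i := by
    rw [Finset.mul_sum]
    refine Finset.sum_congr rfl fun i _ => ?_
    rw [e_add, mul_comm]
    congr 1
    rw [e, e, ← Complex.exp_nat_mul]; congr 1; push_cast; ring
  have h2 := geom_sum_mul (e θ) n
  have h3 : ‖∑ i ∈ Finset.range n, e θ ^ i‖ * ‖e θ - 1‖ ≤ 2 := by
    rw [← norm_mul, h2]
    calc _ ≤ ‖e θ ^ n‖ + ‖(1 : ℂ)‖ := norm_sub_le _ _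
      _ = 2 := by rw [norm_pow, norm_e]; norm_num
  rw [h1, norm_mul, norm_e, one_mul]
  have h4 := four_mul_le_norm_e_sub_one θ
  have h5 := mul_le_mul_of_nonneg_left h4 (norm_nonneg (∑ i ∈ Finset.range n, e θ ^ i))
  linarith

/-- Weyl differencing. -/
theorem normSq_sum_le (z : ℕ → ℂ) (M : ℕ) :
    ‖∑ i ∈ Finset.range M, z i‖ ^ 2 ≤ 2 * ∑ h ∈ Finset.range M,
      ‖∑ i ∈ Finset.range (M - h), z (i + h) * (starRingEnd ℂ) (z i)‖ := by
  -- Only the pairs on one side of the diagonal are kept, with a factor 2; the diagonal, then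
  -- counted twice, gives the slack in the induction.
  have key : ‖∑ i ∈ Finset.range M, z i‖ ^ 2 ≤
      2 * (∑ m ∈ Finset.range M, ∑ h ∈ Finset.range (m + 1),
        z m * (starRingEnd ℂ) (z h)).re := by
    induction M with
    | zero => simp
    | succ M ih =>
      rw [Finset.sum_range_succ, Finset.sum_range_succ _ M, Complex.add_re, mul_add]
      set S := ∑ i ∈ Finset.range M, z i with hS
      have h1 : ∑ h ∈ Finset.range (M + 1), z M * (starRingEnd ℂ) (z h)
          = z M * (starRingEnd ℂ) (S + z M) := by
        rw [← Finset.mul_sum, Finset.sum_range_succ, ← map_sum, map_add]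
      rw [h1]
      have h2 : ‖S + z M‖ ^ 2 = ‖S‖ ^ 2 + 2 * (z M * (starRingEnd ℂ) (S + z M)).re - ‖z M‖ ^ 2 := by
        simp only [← Complex.normSq_eq_norm_sq, Complex.normSq_apply]
        simp
        ring
      nlinarith [sq_nonneg ‖z M‖]
  refine key.trans ?_
  gcongr
  have hflip : ∑ m ∈ Finset.range M, ∑ h ∈ Finset.range (m + 1), z m * (starRingEnd ℂ) (z h)
      = ∑ h ∈ Finset.range M, ∑ i ∈ Finset.range (M - h), z (i + h) * (starRingEnd ℂ) (z i) := by
    rw [← Finset.sum_range_diag_flip M (fun h i => z (i + h) * (starRingEnd ℂ) (z i))]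
    refine Finset.sum_congr rfl fun m _ => ?_
    rw [← Finset.sum_range_reflect]
    refine Finset.sum_congr rfl fun h hh => ?_
    have : h ≤ m := by simpa [Nat.lt_succ_iff] using hh
    simp only [Nat.add_sub_cancel]
    rw [show m - h + h = m by omega]
  rw [hflip]
  exact (Complex.re_le_norm _).trans (norm_sum_le _ _)

/-! ### Sums of the reciprocal distance to the nearest integer -/

/-- `∑_{i ≤ I} 2^i 1(‖x‖ ≤ 2^{-i})`, a majorant of `min(2^I, 1 / (2‖x‖))`. -/
noncomputable def dyadicMajorant (I : ℕ) (x : ℝ) : ℝ :=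
  ∑ i ∈ Finset.range (I + 1), if |x - round x| ≤ (1 / 2) ^ i then 2 ^ i else 0

theorem dyadicMajorant_nonneg (I : ℕ) (x : ℝ) : 0 ≤ dyadicMajorant I x :=
  Finset.sum_nonneg fun i _ => by split_ifs <;> positivity

theorem le_dyadicMajorant {I : ℕ} {x A : ℝ} (h1 : A ≤ 2 ^ I) (h2 : A * (2 * |x - round x|) ≤ 1) :
    A ≤ dyadicMajorant I x := by
  induction I with
  | zero =>
    have : |x - round x| ≤ 1 := (abs_sub_round x).trans (by norm_num)
    simpa [dyadicMajorant, this] using h1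
  | succ I ih =>
    rw [dyadicMajorant, Finset.sum_range_succ]
    by_cases hx : |x - round x| ≤ (1 / 2) ^ (I + 1)
    · rw [if_pos hx]
      have := dyadicMajorant_nonneg I x
      rw [dyadicMajorant] at this
      linarith
    · rw [if_neg hx, add_zero]
      refine ih ?_
      by_contra! hA
      push Not at hx
      have h3 : (2 : ℝ) ^ I * (2 * (1 / 2) ^ (I + 1)) = 1 := by
        rw [pow_succ, one_div, inv_pow]; field_simp
      have h4 : (2 : ℝ) ^ I * (2 * (1 / 2) ^ (I + 1)) < A * (2 * |x - round x|) := by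
        apply mul_lt_mul hA (by linarith) (by positivity)
        have : (0 : ℝ) < 2 ^ I := by positivity
        linarith
      linarith

theorem abs_le_abs_int_add_sub {y : ℝ} (hy : |y| ≤ 1 / 2) (a z : ℤ) : |y| ≤ |(a : ℝ) + y - z| := by
  by_cases h : a = z
  · rw [h]; simp
  · have h1 : (1 : ℝ) ≤ |((a - z : ℤ) : ℝ)| := by
      have : (1 : ℤ) ≤ |a - z| := Int.one_le_abs (sub_ne_zero.2 h)
      exact_mod_cast this
    have h2 := abs_sub_abs_le_abs_sub (((a - z : ℤ) : ℝ)) (-y)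
    rw [abs_neg] at h2
    rw [show (a : ℝ) + y - z = ((a - z : ℤ) : ℝ) - (-y) by push_cast; ring]
    linarith

/-- Counting `k ≤ K` with `‖k β‖ ≤ δ` when `β` has the rational approximation `u / t`. -/
theorem card_level_le {β δ : ℝ} {t : ℕ} {u : ℤ} {K : ℕ} (hK : 0 < K) (ht : 0 < t)
    (hut : IsCoprime u (t : ℤ)) (htK : t ≤ 2 * K) (hβ : |t * β - u| ≤ 1 / (2 * K)) (hδ : 0 < δ) :
    ∃ c : ℕ, (c : ℝ) * t ≤ K ∧ c * |t * β - u| ≤ δ ∧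
      (((Finset.Icc 1 K).filter (fun k : ℕ => |k * β - round (k * β)| ≤ δ)).card : ℝ)
        ≤ 18 * K * δ + c := by
  have ht' : (0 : ℝ) < t := by exact_mod_cast ht
  have hK' : (0 : ℝ) < K := by exact_mod_cast hK
  set s := (Finset.Icc 1 K).filter (fun k : ℕ => |k * β - round (k * β)| ≤ δ) with hs
  set s1 := s.filter (fun k => t ∣ k) with hs1
  set s2 := s.filter (fun k => ¬ t ∣ k) with hs2
  have hmem : ∀ k ∈ s, 1 ≤ k ∧ k ≤ K ∧ |k * β - round (k * β)| ≤ δ := by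
    intro k hk
    simp only [hs, Finset.mem_filter, Finset.mem_Icc] at hk
    exact ⟨hk.1.1, hk.1.2, hk.2⟩
  have hmul : ∀ j : ℕ, t * j ∈ s → (j : ℝ) * t ≤ K ∧ j * |t * β - u| ≤ δ := by
    intro j hj
    obtain ⟨h1, h2, h3⟩ := hmem _ hj
    have h2' : (j : ℝ) * t ≤ K := by rw [mul_comm]; exact_mod_cast h2
    refine ⟨h2', ?_⟩
    -- At $k=tj$ the number $k\beta$ is the integer $ju$ plus $j(t\beta-u)$. The latter is at most
    -- $\frac12$ in size, so no integer is closer than $j|t\beta-u|$.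
    have hsmall : |(j : ℝ) * (t * β - u)| ≤ 1 / 2 := by
      rw [abs_mul, Nat.abs_cast]
      have hjK : (j : ℝ) ≤ K := by
        have : (1 : ℝ) ≤ t := by exact_mod_cast ht
        nlinarith [(Nat.cast_nonneg j : (0 : ℝ) ≤ j)]
      calc (j : ℝ) * |t * β - u| ≤ K * (1 / (2 * K)) := by gcongr
        _ = 1 / 2 := by field_simp
    have h4 := abs_le_abs_int_add_sub hsmall (j * u) (round (((t * j : ℕ) : ℝ) * β))
    have h5 : (((j : ℤ) * u : ℤ) : ℝ) + j * (t * β - u) = ((t * j : ℕ) : ℝ) * β := by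
      push_cast; ring
    rw [h5] at h4
    rw [abs_mul, Nat.abs_cast] at h4
    exact h4.trans h3
  refine ⟨s1.card, ?_, ?_, ?_⟩
  iterate 2
    rcases Nat.eq_zero_or_pos s1.card with h0 | h0
    · rw [h0]; simp [hδ.le]
    -- The counted multiples $tj$ of $t$ have distinct $j\ge1$, so the largest $j$ is at least their
    -- number, and the bounds for that $j$ pass to the number.
    · obtain ⟨j, hj, hcj⟩ : ∃ j, t * j ∈ s ∧ s1.card ≤ j := by
        by_contra! hcon
        have : s1.card ≤ (Finset.Icc 1 (s1.card - 1)).card := by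
          refine Finset.card_le_card_of_injOn (fun k => k / t) ?_ ?_
          · intro k hk
            have hk : k ∈ s1 := hk
            rw [hs1, Finset.mem_filter] at hk
            obtain ⟨hk, j, rfl⟩ := hk
            have h1 := hcon j hk
            have h2 := (hmem _ hk).1
            have h3 : 0 < j := Nat.pos_of_ne_zero (by rintro rfl; simp at h2)
            simp only [Finset.coe_Icc, Set.mem_Icc, Nat.mul_div_cancel_left _ ht]
            omega
          · intro k hk k' hk' h
            have hk : k ∈ s1 := hk
            have hk' : k' ∈ s1 := hk'
            rw [hs1, Finset.mem_filter] at hk hk'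
            exact (Nat.div_left_inj hk.2 hk'.2).1 h
        rw [Nat.card_Icc] at this
        omega
      have hcj' : (s1.card : ℝ) ≤ j := by exact_mod_cast hcj
      first
        | exact (mul_le_mul_of_nonneg_right hcj' ht'.le).trans (hmul j hj).1
        | exact (mul_le_mul_of_nonneg_right hcj' (abs_nonneg _)).trans (hmul j hj).2
  have hsplit : (s.card : ℝ) = s1.card + s2.card := by
    rw [hs1, hs2]; exact_mod_cast (Finset.card_filter_add_card_filter_not _).symm
  have hs2card : (s2.card : ℝ) ≤ 18 * K * δ := by
    rcases s2.eq_empty_or_nonempty with h0 | ⟨k₀, hk₀⟩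
    · rw [h0]; simp; positivity
    have hnear : ∀ k ∈ s2, |(k : ℝ) * ((u : ℝ) / t) - round ((k : ℝ) * β)| ≤ δ + 1 / (2 * t) := by
      intro k hk
      rw [hs2, Finset.mem_filter] at hk
      obtain ⟨h1, h2, h3⟩ := hmem k hk.1
      have h4 : |(k : ℝ) * ((u : ℝ) / t) - k * β| ≤ 1 / (2 * t) := by
        have : (k : ℝ) * ((u : ℝ) / t) - k * β = -((k : ℝ) / t * (t * β - u)) := by
          field_simp; ring
        rw [this, abs_neg, abs_mul, abs_of_nonneg (by positivity)]
        have hkK : (k : ℝ) ≤ K := by exact_mod_cast h2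
        calc (k : ℝ) / t * |t * β - u| ≤ K / t * (1 / (2 * K)) := by gcongr
          _ = 1 / (2 * t) := by field_simp
      have := abs_sub_le ((k : ℝ) * ((u : ℝ) / t)) (k * β) (round ((k : ℝ) * β))
      linarith
    -- If $t\nmid k$ then $ku/t$ is at least $1/t$ from every integer, while replacing $\beta$ by
    -- $u/t$ moves it by at most $1/(2t)$. So a single such $k$ forces $\delta\ge 1/(2t)$.
    have hδt : 1 / (2 * t) ≤ δ := by
      have h1 := hnear k₀ hk₀
      have h2 : (1 : ℝ) / t ≤ |(k₀ : ℝ) * ((u : ℝ) / t) - round ((k₀ : ℝ) * β)| := by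
        have hne : (k₀ : ℤ) * u - round ((k₀ : ℝ) * β) * t ≠ 0 := by
          intro h
          rw [hs2, Finset.mem_filter] at hk₀
          apply hk₀.2
          have : (t : ℤ) ∣ (k₀ : ℤ) * u := ⟨round ((k₀ : ℝ) * β), by linear_combination h⟩
          exact_mod_cast hut.symm.dvd_of_dvd_mul_right this
        have h3 : (1 : ℝ) ≤ |(((k₀ : ℤ) * u - round ((k₀ : ℝ) * β) * t : ℤ) : ℝ)| := by
          exact_mod_cast Int.one_le_abs hne
        have h4 : (k₀ : ℝ) * ((u : ℝ) / t) - round ((k₀ : ℝ) * β)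
            = (((k₀ : ℤ) * u - round ((k₀ : ℝ) * β) * t : ℤ) : ℝ) / t := by
          push_cast; field_simp
        rw [h4, abs_div, abs_of_pos ht']
        gcongr
      have h5 : (1 : ℝ) / t = 1 / (2 * t) + 1 / (2 * t) := by field_simp; norm_num
      linarith
    have h1 := card_near_int_le ht hut (δ := 2 * δ) (by positivity) K (s := s2)
      (fun k hk => by
        rw [hs2, Finset.mem_filter] at hk
        exact ⟨(hmem k hk.1).1, (hmem k hk.1).2.1⟩)
      (fun k hk => ⟨_, (hnear k hk).trans (by linarith)⟩)
    have h6 : 1 ≤ 2 * t * δ := by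
      rw [div_le_iff₀ (by positivity)] at hδt; linarith
    have htK' : (t : ℝ) ≤ 2 * K := by exact_mod_cast htK
    calc (s2.card : ℝ) ≤ ((K : ℝ) / t + 1) * (2 * t * (2 * δ) + 1) := h1
      _ ≤ ((K : ℝ) / t + 1) * (6 * t * δ) := by gcongr; linarith
      _ = 6 * δ * (K + t) := by field_simp
      _ ≤ 6 * δ * (K + 2 * K) := by gcongr
      _ = _ := by ring
  rw [hsplit]; linarith

/-- Level by level, `card_level_le` at $\delta=2^{-i}$ contributes $18K$ from the non-multiples of
$t$ and $c\,2^i$ from the multiples. The two bounds for $c$ correspond to the two entries of the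
maximum. In use $D=LH^2$, with $2^I\le 2H$ and $K\le 2LH$. -/
theorem sum_dyadicMajorant_le {β D : ℝ} {t : ℕ} {u : ℤ} {K I : ℕ} (hK : 0 < K) (ht : 0 < t)
    (hut : IsCoprime u (t : ℤ)) (htK : t ≤ 2 * K) (hβ : |t * β - u| ≤ 1 / (2 * K))
    (hD : 2 ^ I * (K : ℝ) ≤ 4 * D) :
    ∑ k ∈ Finset.Icc 1 K, dyadicMajorant I (k * β)
      ≤ (I + 1) * (18 * K + 4 * D / max (t : ℝ) (|t * β - u| * D)) := by
  simp only [dyadicMajorant]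
  rw [Finset.sum_comm]
  have ht' : (0 : ℝ) < t := by exact_mod_cast ht
  have hK' : (0 : ℝ) < K := by exact_mod_cast hK
  have hD0 : 0 < D := by
    have : (0 : ℝ) < 2 ^ I * K := by positivity
    linarith
  have : ∀ i ∈ Finset.range (I + 1), ∑ k ∈ Finset.Icc 1 K,
      (if |(k : ℝ) * β - round ((k : ℝ) * β)| ≤ (1 / 2) ^ i then (2 : ℝ) ^ i else 0)
      ≤ 18 * K + 4 * D / max (t : ℝ) (|t * β - u| * D) := by
    intro i hi
    have hiI : i ≤ I := by simpa [Nat.lt_succ_iff] using hi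
    rw [← Finset.sum_filter, Finset.sum_const, nsmul_eq_mul]
    obtain ⟨c, hc1, hc2, hc3⟩ := card_level_le hK ht hut htK hβ (δ := (1 / 2) ^ i) (by positivity)
    have h2i : (1 / 2 : ℝ) ^ i * 2 ^ i = 1 := by rw [← mul_pow]; norm_num
    have h1 : (c : ℝ) * 2 ^ i ≤ 4 * D / max (t : ℝ) (|t * β - u| * D) := by
      rw [le_div_iff₀ (lt_max_of_lt_left ht')]
      rcases max_cases (t : ℝ) (|t * β - u| * D) with ⟨h, _⟩ | ⟨h, _⟩
      · rw [h]
        calc (c : ℝ) * 2 ^ i * t = c * t * 2 ^ i := by ring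
          _ ≤ K * 2 ^ I := by gcongr; norm_num
          _ ≤ 4 * D := by linarith
      · rw [h]
        calc (c : ℝ) * 2 ^ i * (|t * β - u| * D) = (c * |t * β - u|) * 2 ^ i * D := by ring
          _ ≤ (1 / 2) ^ i * 2 ^ i * D := by gcongr
          _ = D := by rw [h2i, one_mul]
          _ ≤ 4 * D := by linarith
    calc _ ≤ (18 * K * (1 / 2) ^ i + c) * (2 : ℝ) ^ i := by gcongr
      _ = 18 * K * ((1 / 2) ^ i * 2 ^ i) + c * 2 ^ i := by ring
      _ ≤ _ := by rw [h2i]; linarith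
  refine (Finset.sum_le_sum this).trans ?_
  rw [Finset.sum_const, Finset.card_range, nsmul_eq_mul]
  push_cast
  exact le_rfl

theorem exists_eq_Ico_of_ordConnected (J : Finset ℕ) (hJ : (J : Set ℕ).OrdConnected) :
    ∃ n M : ℕ, J = Finset.Ico n (n + M) := by
  rcases J.eq_empty_or_nonempty with rfl | hne
  · exact ⟨0, 0, by simp⟩
  · refine ⟨J.min' hne, J.max' hne + 1 - J.min' hne, ?_⟩
    have hle := J.min'_le_max' hne
    ext x
    rw [Finset.mem_Ico]
    refine ⟨fun hx => ?_, fun hx => ?_⟩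
    · have h1 := J.min'_le x hx
      have h2 := J.le_max' x hx
      omega
    · exact hJ.out (J.min'_mem hne) (J.max'_mem hne) ⟨hx.1, by omega⟩

/-! ### Weyl's inequality on average over ℓ -/

/-- Weyl's bound for one inner sum, in terms of the majorant. -/
theorem normSq_sum_e_g_le {N H : ℝ} {S : ℕ → Set ℝ} (hN : 0 ≤ N) (hS : IsSubintervalFamily N S)
    {m : ℕ} (hm : 0 < m) (hH : N / m ≤ H) {I : ℕ} (hI : H ≤ 2 ^ I) (a : ℤ) (q : ℕ) (b c : ℝ)
    (l : ℕ) :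
    ‖∑ n ∈ integersIn N S m, e ((l : ℝ) * g a q b c ((m : ℝ) * n))‖ ^ 2
      ≤ 2 * H + 2 * ∑ h ∈ Finset.Icc 1 ⌊H⌋₊,
          dyadicMajorant I (((2 * l * h : ℕ) : ℝ) * ((m : ℝ) ^ 2 * (a / q))) := by
  have hord : ((integersIn N S m : Finset ℕ) : Set ℕ).OrdConnected := by
    refine ⟨fun x hx y hy z hz => ?_⟩
    rw [Finset.mem_coe, mem_integersIn hN hS hm] at hx hy ⊢
    exact (hS m hm).1.out hx hy ⟨by exact_mod_cast hz.1, by exact_mod_cast hz.2⟩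
  obtain ⟨n₀, M, hJ⟩ := exists_eq_Ico_of_ordConnected _ hord
  have hH0 : 0 ≤ H := le_trans (by positivity) hH
  -- The integers counted are at least 1, so the length `M` of the block is at most its last
  -- element.
  have hMH : M ≤ ⌊H⌋₊ := by
    rcases Nat.eq_zero_or_pos M with rfl | hM
    · simp
    have h1 : n₀ + M - 1 ∈ integersIn N S m := by rw [hJ, Finset.mem_Ico]; omega
    have h2 : n₀ ∈ integersIn N S m := by rw [hJ, Finset.mem_Ico]; omega
    simp only [integersIn, Finset.mem_filter, Finset.mem_Icc] at h1 h2
    have h3 : ⌊N / (m : ℝ)⌋₊ ≤ ⌊H⌋₊ := Nat.floor_le_floor hH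
    omega
  have hMH' : (M : ℝ) ≤ H := (Nat.le_floor_iff hH0).1 hMH
  rw [hJ, Finset.sum_Ico_eq_sum_range, Nat.add_sub_cancel_left]
  refine (normSq_sum_le _ M).trans ?_
  have hterm : ∀ h ∈ Finset.range M,
      ‖∑ i ∈ Finset.range (M - h), e ((l : ℝ) * g a q b c ((m : ℝ) * ((n₀ + (i + h) : ℕ) : ℝ))) *
        (starRingEnd ℂ) (e ((l : ℝ) * g a q b c ((m : ℝ) * ((n₀ + i : ℕ) : ℝ))))‖
      ≤ if h = 0 then H else
        dyadicMajorant I (((2 * l * h : ℕ) : ℝ) * ((m : ℝ) ^ 2 * (a / q))) := by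
    intro h hh
    have htriv : ‖∑ i ∈ Finset.range (M - h),
        e ((l : ℝ) * g a q b c ((m : ℝ) * ((n₀ + (i + h) : ℕ) : ℝ))) *
        (starRingEnd ℂ) (e ((l : ℝ) * g a q b c ((m : ℝ) * ((n₀ + i : ℕ) : ℝ))))‖ ≤ H := by
      refine (norm_sum_le _ _).trans ?_
      rw [Finset.sum_congr rfl (g := fun _ => (1 : ℝ))
        (fun i _ => by rw [norm_mul, RCLike.norm_conj, norm_e, norm_e, one_mul])]
      simp only [Finset.sum_const, Finset.card_range, nsmul_eq_mul, mul_one]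
      exact le_trans (by exact_mod_cast Nat.sub_le M h) hMH'
    split_ifs with h0
    · exact htriv
    · refine le_dyadicMajorant (htriv.trans hI) ?_
      -- Differencing the quadratic phase leaves a linear one of slope $2\ell h\,m^2a/q$; $\beta$
      -- and $\gamma$ do not enter the slope.
      have hlin : ∀ i ∈ Finset.range (M - h),
          e ((l : ℝ) * g a q b c ((m : ℝ) * ((n₀ + (i + h) : ℕ) : ℝ))) *
          (starRingEnd ℂ) (e ((l : ℝ) * g a q b c ((m : ℝ) * ((n₀ + i : ℕ) : ℝ))))
          = e ((((2 * l * h : ℕ) : ℝ) * ((m : ℝ) ^ 2 * (a / q))) * i +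
            l * (a / q * m ^ 2 * (2 * n₀ * h + h ^ 2) + b * m * h)) := by
        intro i _
        rw [conj_e, ← e_add]
        congr 1
        simp only [g]
        push_cast
        ring
      rw [Finset.sum_congr rfl hlin]
      exact norm_sum_e_linear_le _ _ _
  have hsum := Finset.sum_le_sum hterm
  refine (mul_le_mul_of_nonneg_left hsum zero_le_two).trans ?_
  rw [← mul_add]
  gcongr
  calc _ ≤ ∑ h ∈ Finset.range (⌊H⌋₊ + 1), (if h = 0 then H else
        dyadicMajorant I (((2 * l * h : ℕ) : ℝ) * ((m : ℝ) ^ 2 * (a / q)))) := by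
        refine Finset.sum_le_sum_of_subset_of_nonneg (fun x hx => ?_) (fun x _ _ => ?_)
        · simp only [Finset.mem_range] at hx ⊢; omega
        · split_ifs
          · exact hH0
          · exact dyadicMajorant_nonneg _ _
    _ = _ := by
        rw [Finset.sum_range_succ', if_pos rfl, add_comm]
        congr 1
        rw [Finset.range_eq_Ico, Finset.sum_Ico_add' (fun h => if h = 0 then H else
          dyadicMajorant I (((2 * l * h : ℕ) : ℝ) * ((m : ℝ) ^ 2 * (a / q)))) 0 ⌊H⌋₊ 1]
        refine Finset.sum_congr (by ext; simp) fun h hh => ?_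
        rw [if_neg (by simp at hh; omega)]

/-- Mean square over `ℓ` of the inner sums for one modulus `m`. -/
theorem sum_normSq_le {N H L τ : ℝ} {S : ℕ → Set ℝ} (hN : 0 ≤ N) (hS : IsSubintervalFamily N S)
    {m : ℕ} (hm : 0 < m) (hH : N / m ≤ H) (hH1 : 1 ≤ H) (hL1 : 1 ≤ L)
    {I : ℕ} (hI : H ≤ 2 ^ I) (hI2 : 2 ^ I ≤ 2 * H)
    (a : ℤ) (q : ℕ) (b c : ℝ) {t : ℕ} {u : ℤ} (ht : 0 < t) (hut : IsCoprime u (t : ℤ))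
    {K : ℕ} (hKdef : K = 2 * ⌊L⌋₊ * ⌊H⌋₊)
    (htK : t ≤ 2 * K) (hβ : |t * ((m : ℝ) ^ 2 * (a / q)) - u| ≤ 1 / (2 * K))
    (hτ : ∀ n : ℕ, 0 < n → n ≤ K → (n.divisors.card : ℝ) ≤ τ) :
    ∑ l ∈ Finset.Icc 1 ⌊L⌋₊, ‖∑ n ∈ integersIn N S m, e ((l : ℝ) * g a q b c ((m : ℝ) * n))‖ ^ 2
      ≤ 2 * L * H + 2 * τ * ((I + 1) * (36 * (L * H) + 4 * (L * H ^ 2) /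
          max (t : ℝ) (|t * ((m : ℝ) ^ 2 * (a / q)) - u| * (L * H ^ 2)))) := by
  have hL0 : 0 < ⌊L⌋₊ := Nat.floor_pos.2 hL1
  have hH0 : 0 < ⌊H⌋₊ := Nat.floor_pos.2 hH1
  have hK : 0 < K := by rw [hKdef]; positivity
  have hKLH : (K : ℝ) ≤ 2 * (L * H) := by
    rw [hKdef]; push_cast
    have h1 : (⌊L⌋₊ : ℝ) ≤ L := Nat.floor_le (by linarith)
    have h2 : (⌊H⌋₊ : ℝ) ≤ H := Nat.floor_le (by linarith)
    calc (2 : ℝ) * ⌊L⌋₊ * ⌊H⌋₊ ≤ 2 * L * H := by gcongr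
      _ = _ := by ring
  set β : ℝ := (m : ℝ) ^ 2 * (a / q) with hβdef
  have hτ0 : 0 ≤ τ := le_trans (by positivity) (hτ 1 one_pos hK)
  refine (Finset.sum_le_sum fun l _ =>
    normSq_sum_e_g_le hN hS hm hH hI a q b c l).trans ?_
  rw [Finset.sum_add_distrib]
  have h0 := Finset.mul_sum (Finset.Icc 1 ⌊L⌋₊) (fun l => ∑ h ∈ Finset.Icc 1 ⌊H⌋₊,
      dyadicMajorant I (((2 * l * h : ℕ) : ℝ) * β)) 2
  have h1 : ∑ l ∈ Finset.Icc 1 ⌊L⌋₊, 2 * H ≤ 2 * L * H := by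
    rw [Finset.sum_const, nsmul_eq_mul, Nat.card_Icc, Nat.add_sub_cancel]
    have : (⌊L⌋₊ : ℝ) ≤ L := Nat.floor_le (by linarith)
    nlinarith
  have h2 : ∑ l ∈ Finset.Icc 1 ⌊L⌋₊, ∑ h ∈ Finset.Icc 1 ⌊H⌋₊,
      dyadicMajorant I (((2 * l * h : ℕ) : ℝ) * β)
      ≤ τ * ∑ k ∈ Finset.Icc 1 K, dyadicMajorant I (k * β) := by
    rw [← Finset.sum_product']
    refine sum_comp_le_mul_sum (s := Finset.Icc 1 ⌊L⌋₊ ×ˢ Finset.Icc 1 ⌊H⌋₊)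
      (f := fun p => 2 * p.1 * p.2) (B := fun k : ℕ => dyadicMajorant I ((k : ℝ) * β)) ?_
      (fun _ _ => dyadicMajorant_nonneg _ _) ?_
    · intro p hp
      simp only [Finset.mem_product, Finset.mem_Icc] at hp ⊢
      refine ⟨Nat.mul_pos (by omega) (by omega), ?_⟩
      rw [hKdef]
      exact Nat.mul_le_mul (by omega) hp.2.2
    · intro k hk
      rw [Finset.mem_Icc] at hk
      refine le_trans ?_ (hτ k hk.1 hk.2)
      norm_cast
      -- Given $k=2\ell h$, the divisor $\ell$ determines $h$.
      refine Finset.card_le_card_of_injOn Prod.fst ?_ ?_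
      · intro p hp
        simp only [Finset.coe_filter, Set.mem_ofPred_eq] at hp
        simp only [Finset.mem_coe, Nat.mem_divisors]
        exact ⟨⟨2 * p.2, by rw [← hp.2]; ring⟩, by omega⟩
      · intro p hp p' hp' h
        simp only [Finset.coe_filter, Set.mem_ofPred_eq, Finset.mem_product, Finset.mem_Icc] at hp hp'
        have h3 : 2 * p.1 * p.2 = 2 * p.1 * p'.2 := by rw [hp.2, h, hp'.2]
        exact Prod.ext h (Nat.eq_of_mul_eq_mul_left (by omega) h3)
  have h3 := sum_dyadicMajorant_le (D := L * H ^ 2) (I := I) hK ht hut htK hβ (by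
    calc 2 ^ I * (K : ℝ) ≤ (2 * H) * (2 * (L * H)) := by gcongr
      _ = _ := by ring)
  have h4 : ∑ k ∈ Finset.Icc 1 K, dyadicMajorant I (k * β) ≤
      (I + 1) * (36 * (L * H) + 4 * (L * H ^ 2) / max (t : ℝ) (|t * β - u| * (L * H ^ 2))) := by
    refine h3.trans (mul_le_mul_of_nonneg_left ?_ (by positivity))
    linarith
  have h5 := h2.trans (mul_le_mul_of_nonneg_left h4 hτ0)
  linarith


/-! ### Good approximations for fixed w -/

theorem exists_coprime_approx (β : ℝ) {n : ℕ} (hn : 0 < n) :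
    ∃ (t : ℕ) (u : ℤ), 0 < t ∧ IsCoprime u (t : ℤ) ∧ t ≤ n ∧ |t * β - u| ≤ 1 / n := by
  obtain ⟨r, hr, hd⟩ := Real.exists_rat_abs_sub_le_and_den_le β hn
  have hpos : (0 : ℝ) < r.den := by exact_mod_cast r.pos
  have hn' : (0 : ℝ) < n := by exact_mod_cast hn
  refine ⟨r.den, r.num, r.pos, ?_, hd, ?_⟩
  · rw [Int.isCoprime_iff_gcd_eq_one]
    exact r.reduced
  · have h1 : (r.den : ℝ) * β - r.num = r.den * (β - r) := by
      rw [Rat.cast_def]; field_simp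
    rw [h1, abs_mul, Nat.abs_cast]
    calc (r.den : ℝ) * |β - r| ≤ r.den * (1 / ((n + 1) * r.den)) := by gcongr
      _ = 1 / (n + 1) := by field_simp
      _ ≤ 1 / n := by gcongr; linarith

/-- Write $e=b^2a$ with $a$ squarefree and take $f=ba$; then $f^2=b^2a^2\ge e$. -/
theorem exists_dvd_of_dvd_sq {e : ℕ} (he : 0 < e) :
    ∃ f : ℕ, 0 < f ∧ e ≤ f ^ 2 ∧ ∀ v : ℕ, 0 < v → e ∣ v ^ 2 → f ∣ v := by
  obtain ⟨a, b, ha, hb, rfl, hsq⟩ := Nat.sq_mul_squarefree_of_pos he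
  refine ⟨b * a, by positivity, by nlinarith [Nat.mul_pos (pow_pos hb 2) ha], fun v hv h => ?_⟩
  have h1 : b ∣ v := (Nat.pow_dvd_pow_iff two_ne_zero).1 ((Dvd.intro _ rfl).trans h)
  obtain ⟨c, rfl⟩ := h1
  rw [mul_pow] at h
  have h2 : a ∣ c ^ 2 := Nat.dvd_of_mul_dvd_mul_left (pow_pos hb 2) h
  exact Nat.mul_dvd_mul_left b ((hsq.dvd_pow_iff_dvd two_ne_zero).1 h2)

theorem card_sq_multiples_le {e : ℕ} (he : 0 < e) {V : ℝ} (hV : 0 ≤ V) {s : Finset ℕ}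
    (hs : ∀ v ∈ s, 0 < v ∧ (v : ℝ) ≤ V ∧ e ∣ v ^ 2) : (s.card : ℝ) ≤ V / √e := by
  obtain ⟨f, hf, hef, hdvd⟩ := exists_dvd_of_dvd_sq he
  have he' : (0 : ℝ) < e := by exact_mod_cast he
  have hf' : (0 : ℝ) < f := by exact_mod_cast hf
  have h1 : s.card ≤ (Finset.Icc 1 ⌊V / f⌋₊).card := by
    refine Finset.card_le_card_of_injOn (fun v => v / f) ?_ ?_
    · intro v hv
      obtain ⟨h1, h2, h3⟩ := hs v hv
      obtain ⟨c, rfl⟩ := hdvd v h1 h3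
      simp only [Finset.coe_Icc, Set.mem_Icc, Nat.mul_div_cancel_left _ hf]
      refine ⟨Nat.pos_of_ne_zero (by rintro rfl; simp at h1), Nat.le_floor ?_⟩
      rw [le_div_iff₀ hf', mul_comm]
      exact_mod_cast h2
    · intro v hv v' hv' h
      exact (Nat.div_left_inj (hdvd v (hs v hv).1 (hs v hv).2.2)
        (hdvd v' (hs v' hv').1 (hs v' hv').2.2)).1 h
  rw [Nat.card_Icc, Nat.add_sub_cancel] at h1
  calc (s.card : ℝ) ≤ ⌊V / f⌋₊ := by exact_mod_cast h1
    _ ≤ V / f := Nat.floor_le (by positivity)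
    _ ≤ V / √e := by
      have : √(e : ℝ) ≤ f := by
        rw [Real.sqrt_le_left hf'.le]; exact_mod_cast hef
      have h0 : 0 < √(e : ℝ) := Real.sqrt_pos.2 he'
      gcongr

/-- For one `β`, the `v ∼ V` such that `t_v v² β` is near an integer `u_v` with `(t_v, u_v) = 1`:
either they are few, or all the fractions `u_v / (t_v v²)` agree and `v²` has a fixed divisor. -/
theorem card_slice_le {β V Y Z τ : ℝ} {K : ℕ} (hK : 0 < K) (hV : 0 < V) (hZ : 0 ≤ Z)
    {G : Finset ℕ} {t : ℕ → ℕ} {u : ℕ → ℤ}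
    (hG : ∀ v ∈ G, V < v ∧ (v : ℝ) ≤ 2 * V ∧ 0 < t v ∧ (t v : ℝ) ≤ Y ∧
      IsCoprime (u v) (t v : ℤ) ∧ t v * v ^ 2 ≤ K ∧ |(t v : ℝ) * (v : ℝ) ^ 2 * β - u v| ≤ Z)
    (hτ : ∀ n : ℕ, 0 < n → n ≤ 2 * K → (n.divisors.card : ℝ) ≤ τ) :
    (G.card : ℝ) ≤ 18 * K * Z * τ ∨ ∃ (k e : ℕ) (z : ℤ), 0 < k ∧ 0 < e ∧ (k : ℝ) ≤ Y * e ∧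
      |k * β - z| ≤ Z * e / V ^ 2 ∧ (G.card : ℝ) ≤ τ * (2 * V / √e) := by
  have hK' : (0 : ℝ) < K := by exact_mod_cast hK
  have hτ0 : 0 ≤ τ := le_trans (by positivity) (hτ 1 one_pos (by omega))
  have hvpos : ∀ v ∈ G, 0 < v := fun v hv => by
    have := hV.trans (hG v hv).1
    exact_mod_cast this
  obtain ⟨k₀, u₀, hk₀, hcop, hk₀K, happ⟩ := exists_coprime_approx β (n := 2 * K) (by omega)
  have hk₀' : (0 : ℝ) < k₀ := by exact_mod_cast hk₀
  push_cast at happ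
  -- The dichotomy: do all the fractions $u_v/(t_vv^2)$ equal the Dirichlet approximation $u_0/k_0$
  -- of $\beta$?
  by_cases hall : ∀ v ∈ G, ((t v * v ^ 2 : ℕ) : ℤ) * u₀ = u v * k₀
  · rcases G.eq_empty_or_nonempty with rfl | hne
    · left; simp; positivity
    right
    have hj : ∀ v ∈ G, ∃ j : ℕ, t v * v ^ 2 = k₀ * j ∧ u v = u₀ * j := by
      intro v hv
      have h1 : (k₀ : ℤ) ∣ ((t v * v ^ 2 : ℕ) : ℤ) * u₀ := ⟨u v, by rw [hall v hv]; ring⟩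
      have h2 : (k₀ : ℤ) ∣ ((t v * v ^ 2 : ℕ) : ℤ) := hcop.symm.dvd_of_dvd_mul_right h1
      obtain ⟨j, hj⟩ := Int.natCast_dvd_natCast.1 h2
      refine ⟨j, hj, ?_⟩
      have h3 := hall v hv
      rw [hj] at h3
      have h4 : (k₀ : ℤ) ≠ 0 := by exact_mod_cast hk₀.ne'
      apply mul_right_cancel₀ h4
      rw [← h3]; push_cast; ring
    have htk : ∀ v ∈ G, t v ∣ k₀ := by
      intro v hv
      obtain ⟨j, hj1, hj2⟩ := hj v hv
      have h1 : IsCoprime (j : ℤ) (t v : ℤ) := by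
        have := (hG v hv).2.2.2.2.1
        rw [hj2] at this
        exact this.of_mul_left_right
      have h2 : t v ∣ k₀ * j := ⟨v ^ 2, hj1.symm⟩
      exact (Nat.isCoprime_iff_coprime.1 h1).symm.dvd_of_dvd_mul_right h2
    -- Each $t_v$ divides $k_0$. A most frequent value $d$ loses only a divisor function; with
    -- $k_0=de$, the equation $t_vv^2=k_0j$ becomes $v^2=ej$.
    obtain ⟨d, hd, hmax⟩ := Finset.exists_max_image k₀.divisors
      (fun d => (G.filter (fun v => t v = d)).card) ⟨1, by simp [hk₀.ne']⟩
    have hcard : G.card ≤ k₀.divisors.card * (G.filter (fun v => t v = d)).card := by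
      rw [mul_comm]
      exact Finset.card_le_mul_card_image_of_maps_to
        (fun v hv => Nat.mem_divisors.2 ⟨htk v hv, hk₀.ne'⟩) _ hmax
    set F := G.filter (fun v => t v = d) with hF
    have hFne : F.Nonempty := by
      rw [Finset.nonempty_iff_ne_empty]
      intro h
      rw [h] at hcard
      simp at hcard
      exact hne.ne_empty hcard
    obtain ⟨e, he⟩ := Nat.dvd_of_mem_divisors hd
    have he0 : 0 < e := Nat.pos_of_ne_zero (by rintro rfl; simp at he; omega)
    have hd0 : 0 < d := Nat.pos_of_ne_zero (by rintro rfl; simp at he; omega)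
    have hFe : ∀ v ∈ F, ∃ j : ℕ, v ^ 2 = e * j ∧ u v = u₀ * j ∧ t v = d ∧ v ∈ G := by
      intro v hv
      rw [hF, Finset.mem_filter] at hv
      obtain ⟨j, hj1, hj2⟩ := hj v hv.1
      refine ⟨j, ?_, hj2, hv.2, hv.1⟩
      rw [hv.2, he, mul_assoc] at hj1
      exact Nat.eq_of_mul_eq_mul_left hd0 hj1
    have he' : (0 : ℝ) < e := by exact_mod_cast he0
    refine ⟨k₀, e, u₀, hk₀, he0, ?_, ?_, ?_⟩
    · obtain ⟨v, hv⟩ := hFne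
      obtain ⟨j, -, -, h3, h4⟩ := hFe v hv
      have h5 := (hG v h4).2.2.2.1
      rw [h3] at h5
      rw [he]; push_cast
      gcongr
    · obtain ⟨v, hv⟩ := hFne
      obtain ⟨j, h1, h2, h3, h4⟩ := hFe v hv
      obtain ⟨g1, g2, -, -, -, -, g7⟩ := hG v h4
      have h1' : (v : ℝ) ^ 2 = e * j := by exact_mod_cast h1
      have hv0 : (0 : ℝ) < v := hV.trans g1
      have hj0 : (0 : ℝ) < j := by
        have : (0 : ℝ) < e * j := by rw [← h1']; positivity
        exact pos_of_mul_pos_right this he'.le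
      -- The error at $v$ is $j$ times that of $k_0\beta-u_0$, and $j=v^2/e\ge V^2/e$; this is the
      -- gain in the second alternative.
      have h5 : (t v : ℝ) * (v : ℝ) ^ 2 * β - u v = j * (k₀ * β - u₀) := by
        rw [h1', h2, h3, he]; push_cast; ring
      rw [h5, abs_mul, Nat.abs_cast] at g7
      have h6 : |(k₀ : ℝ) * β - u₀| ≤ Z / j := by
        rw [le_div_iff₀ hj0, mul_comm]; exact g7
      refine h6.trans ?_
      have h7 : (j : ℝ) = (v : ℝ) ^ 2 / e := by rw [h1']; field_simp
      rw [h7, div_div_eq_mul_div]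
      gcongr
    · have h1 : (F.card : ℝ) ≤ 2 * V / √e := card_sq_multiples_le he0 (by positivity)
        (fun v hv => by
          obtain ⟨j, h1, -, -, h4⟩ := hFe v hv
          exact ⟨hvpos v h4, (hG v h4).2.1, ⟨j, h1⟩⟩)
      calc (G.card : ℝ) ≤ ((k₀.divisors.card * F.card : ℕ) : ℝ) := by exact_mod_cast hcard
        _ = k₀.divisors.card * F.card := by push_cast; ring
        _ ≤ τ * (2 * V / √e) := mul_le_mul (hτ k₀ hk₀ hk₀K) h1 (by positivity) hτ0
  · left
    push Not at hall
    obtain ⟨v₁, hv₁, hne⟩ := hall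
    have hdist : ∀ k : ℕ, k ≤ K → ∀ z : ℤ, |(k : ℝ) * β - z| ≤ Z →
        |(k : ℝ) * ((u₀ : ℝ) / k₀) - z| ≤ Z + 1 / (2 * k₀) := by
      intro k hk z hz
      have h4 : |(k : ℝ) * ((u₀ : ℝ) / k₀) - k * β| ≤ 1 / (2 * k₀) := by
        have : (k : ℝ) * ((u₀ : ℝ) / k₀) - k * β = -((k : ℝ) / k₀ * (k₀ * β - u₀)) := by
          field_simp; ring
        rw [this, abs_neg, abs_mul, abs_of_nonneg (by positivity)]
        have hkK : (k : ℝ) ≤ K := by exact_mod_cast hk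
        calc (k : ℝ) / k₀ * |k₀ * β - u₀| ≤ K / k₀ * (1 / (2 * K)) := by gcongr
          _ = 1 / (2 * k₀) := by field_simp
      have := abs_sub_le ((k : ℝ) * ((u₀ : ℝ) / k₀)) (k * β) z
      linarith
    have hcast : ∀ v ∈ G, |((t v * v ^ 2 : ℕ) : ℝ) * β - u v| ≤ Z := by
      intro v hv
      push_cast
      exact (hG v hv).2.2.2.2.2.2
    -- One fraction different from $u_0/k_0$ forces $Z$ to be at least half the spacing $1/k_0$, so
    -- the spacing count loses only a constant.
    have hZk : 1 / (2 * k₀) ≤ Z := by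
      have h1 := hdist _ (hG v₁ hv₁).2.2.2.2.2.1 _ (hcast v₁ hv₁)
      have h2 : (1 : ℝ) / k₀ ≤ |((t v₁ * v₁ ^ 2 : ℕ) : ℝ) * ((u₀ : ℝ) / k₀) - u v₁| := by
        have h3 : (1 : ℝ) ≤ |((((t v₁ * v₁ ^ 2 : ℕ) : ℤ) * u₀ - u v₁ * k₀ : ℤ) : ℝ)| := by
          exact_mod_cast Int.one_le_abs (sub_ne_zero.2 hne)
        have h4 : ((t v₁ * v₁ ^ 2 : ℕ) : ℝ) * ((u₀ : ℝ) / k₀) - u v₁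
            = ((((t v₁ * v₁ ^ 2 : ℕ) : ℤ) * u₀ - u v₁ * k₀ : ℤ) : ℝ) / k₀ := by
          push_cast; field_simp
        rw [h4, abs_div, abs_of_pos hk₀']
        gcongr
      have h5 : (1 : ℝ) / k₀ = 1 / (2 * k₀) + 1 / (2 * k₀) := by field_simp; norm_num
      linarith
    set s := G.image (fun v => t v * v ^ 2) with hs
    have hs1 : ∀ k ∈ s, 1 ≤ k ∧ k ≤ K := by
      intro k hk
      rw [hs, Finset.mem_image] at hk
      obtain ⟨v, hv, rfl⟩ := hk
      exact ⟨Nat.mul_pos (hG v hv).2.2.1 (pow_pos (hvpos v hv) 2), (hG v hv).2.2.2.2.2.1⟩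
    have h1 := card_near_int_le hk₀ hcop (δ := 2 * Z) (by positivity) K hs1 (fun k hk => by
      have hkK := (hs1 k hk).2
      rw [hs, Finset.mem_image] at hk
      obtain ⟨v, hv, rfl⟩ := hk
      exact ⟨u v, (hdist _ hkK _ (hcast v hv)).trans (by linarith)⟩)
    have h6 : 1 ≤ 2 * k₀ * Z := by
      rw [div_le_iff₀ (by positivity)] at hZk; linarith
    have hk₀K' : (k₀ : ℝ) ≤ 2 * K := by exact_mod_cast hk₀K
    have h2 : (s.card : ℝ) ≤ 18 * K * Z := by
      calc (s.card : ℝ) ≤ ((K : ℝ) / k₀ + 1) * (2 * k₀ * (2 * Z) + 1) := h1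
        _ ≤ ((K : ℝ) / k₀ + 1) * (6 * k₀ * Z) := by gcongr; linarith
        _ = 6 * Z * (K + k₀) := by field_simp
        _ ≤ 6 * Z * (K + 2 * K) := by gcongr
        _ = _ := by ring
    have h3 : (G.card : ℝ) ≤ τ * s.card := by
      refine card_le_mul_card (f := fun v => t v * v ^ 2)
        (fun v hv => Finset.mem_image_of_mem _ hv) (fun k hk => ?_)
      obtain ⟨hk1, hk2⟩ := hs1 k hk
      refine le_trans ?_ (hτ k hk1 (by omega))
      norm_cast
      refine Finset.card_le_card (fun v hv => ?_)
      rw [Finset.mem_filter] at hv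
      rw [Nat.mem_divisors]
      exact ⟨hv.2 ▸ Dvd.intro_left _ (by ring : t v * v * v = _) , by omega⟩
    calc (G.card : ℝ) ≤ τ * s.card := h3
      _ ≤ τ * (18 * K * Z) := by gcongr
      _ = _ := by ring

/-! ### Counting w by pairs with equal denominator -/

/-- Cauchy–Schwarz over the at most `Q` values of `k`; coincidences off the diagonal come in
symmetric couples. -/
theorem card_sq_le_mul_card_pairs {B : Finset ℕ} {k : ℕ → ℕ} {Q : ℕ}
    (hB : ∀ w ∈ B, 1 ≤ k w ∧ k w ≤ Q) :
    B.card ^ 2 ≤ Q * (B.card +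
      2 * ((B ×ˢ B).filter (fun p => p.1 < p.2 ∧ k p.1 = k p.2)).card) := by
  set P := (B ×ˢ B).filter (fun p => p.1 < p.2 ∧ k p.1 = k p.2) with hP
  have hmaps : ∀ w ∈ B, k w ∈ Finset.Icc 1 Q := fun w hw => Finset.mem_Icc.2 (hB w hw)
  have h0 : B.card ^ 2 ≤ Q * ∑ κ ∈ Finset.Icc 1 Q, (B.filter (fun w => k w = κ)).card ^ 2 := by
    conv_lhs => rw [Finset.card_eq_sum_card_fiberwise hmaps]
    refine sq_sum_le_card_mul_sum_sq.trans ?_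
    rw [Nat.card_Icc, Nat.add_sub_cancel, Nat.cast_id]
  have hmaps2 : ∀ p ∈ (B ×ˢ B).filter (fun p => k p.1 = k p.2), k p.1 ∈ Finset.Icc 1 Q :=
    fun p hp => hmaps _ (Finset.mem_product.1 (Finset.mem_filter.1 hp).1).1
  have h1 : ∑ κ ∈ Finset.Icc 1 Q, (B.filter (fun w => k w = κ)).card ^ 2
      = ((B ×ˢ B).filter (fun p => k p.1 = k p.2)).card := by
    rw [Finset.card_eq_sum_card_fiberwise hmaps2]
    refine Finset.sum_congr rfl fun κ _ => ?_
    rw [sq, ← Finset.card_product]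
    congr 1
    ext p
    simp only [Finset.mem_product, Finset.mem_filter]
    constructor
    · rintro ⟨⟨h1, h2⟩, h3, h4⟩; exact ⟨⟨⟨h1, h3⟩, by rw [h2, h4]⟩, h2⟩
    · rintro ⟨⟨⟨h1, h3⟩, h5⟩, h2⟩; exact ⟨⟨h1, h2⟩, h3, by rw [← h5, h2]⟩
  have h2 : (B ×ˢ B).filter (fun p => k p.1 = k p.2) ⊆
      (B.image (fun w => (w, w)) ∪ P) ∪ P.image Prod.swap := by
    intro p hp
    rw [Finset.mem_filter, Finset.mem_product] at hp
    simp only [Finset.mem_union, Finset.mem_image]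
    rcases lt_trichotomy p.1 p.2 with h | h | h
    · left; right
      rw [hP, Finset.mem_filter, Finset.mem_product]
      exact ⟨hp.1, h, hp.2⟩
    · left; left
      exact ⟨p.1, hp.1.1, Prod.ext rfl h⟩
    · right
      refine ⟨p.swap, ?_, by simp⟩
      rw [hP, Finset.mem_filter, Finset.mem_product]
      exact ⟨⟨hp.1.2, hp.1.1⟩, h, hp.2.symm⟩
  have h3 : ((B ×ˢ B).filter (fun p => k p.1 = k p.2)).card ≤ B.card + P.card + P.card := by
    refine (Finset.card_le_card h2).trans ((Finset.card_union_le _ _).trans ?_)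
    refine Nat.add_le_add ((Finset.card_union_le _ _).trans ?_) Finset.card_image_le
    exact Nat.add_le_add_right Finset.card_image_le _
  refine h0.trans (Nat.mul_le_mul_left _ ?_)
  rw [h1]
  omega

/-- A large-sieve type bound for `#{w : ‖k(w) w² a / q‖ ≤ Z}`, by counting pairs with equal
`k(w)`. -/
theorem card_sq_le_of_near_int {a : ℤ} {q : ℕ} (hq : 0 < q) (haq : IsCoprime a (q : ℤ))
    {W Q Z τ : ℝ} (hW : 1 ≤ W) (hQ : 1 ≤ Q) (hZ : 0 ≤ Z) {B : Finset ℕ} {k : ℕ → ℕ}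
    (hB : ∀ w ∈ B, W < w ∧ (w : ℝ) ≤ 2 * W ∧ 0 < k w ∧ (k w : ℝ) ≤ Q ∧
      ∃ z : ℤ, |(k w : ℝ) * ((w : ℝ) ^ 2 * (a / q)) - z| ≤ Z)
    (hτ : ∀ n : ℕ, 0 < n → (n : ℝ) ≤ 4 * Q * W ^ 2 → (n.divisors.card : ℝ) ≤ τ) :
    (B.card : ℝ) ^ 2 ≤ Q * (B.card +
      2 * (τ ^ 2 * ((4 * Q * W ^ 2 / q + 1) * (4 * q * Z + 1)))) := by
  have hq' : (0 : ℝ) < q := by exact_mod_cast hq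
  set P := (B ×ˢ B).filter (fun p => p.1 < p.2 ∧ k p.1 = k p.2) with hP
  set M := ⌊4 * Q * W ^ 2⌋₊ with hM
  have hM' : (M : ℝ) ≤ 4 * Q * W ^ 2 := Nat.floor_le (by positivity)
  set f : ℕ × ℕ → ℕ := fun p => k p.1 * ((p.2 - p.1) * (p.2 + p.1)) with hf
  have hmemP : ∀ p ∈ P, p.1 ∈ B ∧ p.2 ∈ B ∧ p.1 < p.2 ∧ k p.1 = k p.2 := by
    intro p hp
    rw [hP, Finset.mem_filter, Finset.mem_product] at hp
    exact ⟨hp.1.1, hp.1.2, hp.2.1, hp.2.2⟩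
  have hfc : ∀ p ∈ P, (f p : ℝ) = k p.1 * ((p.2 : ℝ) ^ 2 - (p.1 : ℝ) ^ 2) := by
    intro p hp
    have := (hmemP p hp).2.2.1
    simp only [hf]
    rw [Nat.cast_mul, Nat.cast_mul, Nat.cast_sub this.le]
    push_cast; ring
  have hfM : ∀ p ∈ P, 1 ≤ f p ∧ f p ≤ M := by
    intro p hp
    obtain ⟨h1, h2, h3, h4⟩ := hmemP p hp
    constructor
    · have := (hB _ h1).2.2.1
      have h5 : 0 < p.2 - p.1 := by omega
      have h6 : 0 < p.2 + p.1 := by omega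
      exact Nat.mul_pos this (Nat.mul_pos h5 h6)
    · apply Nat.le_floor
      rw [hfc p hp]
      have h5 := (hB _ h1).2.2.2.1
      have h6 := (hB _ h2).2.1
      have h7 : (p.2 : ℝ) ^ 2 - (p.1 : ℝ) ^ 2 ≤ 4 * W ^ 2 := by
        have : (p.2 : ℝ) ^ 2 ≤ (2 * W) ^ 2 := by gcongr
        nlinarith [sq_nonneg (p.1 : ℝ)]
      calc (k p.1 : ℝ) * ((p.2 : ℝ) ^ 2 - (p.1 : ℝ) ^ 2) ≤ k p.1 * (4 * W ^ 2) := by gcongr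
        _ ≤ Q * (4 * W ^ 2) := by gcongr
        _ = _ := by ring
  have hPcard : (P.card : ℝ) ≤ τ ^ 2 * ((4 * Q * W ^ 2 / q + 1) * (4 * q * Z + 1)) := by
    have h1 : (P.card : ℝ) ≤ τ ^ 2 * (P.image f).card := by
      refine card_le_mul_card (f := f) (fun p hp => Finset.mem_image_of_mem _ hp) (fun n hn => ?_)
      obtain ⟨p₀, hp₀, rfl⟩ := Finset.mem_image.1 hn
      set n := f p₀
      have hn1 := (hfM p₀ hp₀).1
      have hn2 : (n : ℝ) ≤ 4 * Q * W ^ 2 :=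
        le_trans (by exact_mod_cast (hfM p₀ hp₀).2) hM'
      -- The divisors $w_2-w_1$ and $w_2+w_1$ of $n$ recover the pair, whence the factor $\tau^2$.
      have h2 : (P.filter (fun p => f p = n)).card ≤ (n.divisors ×ˢ n.divisors).card := by
        refine Finset.card_le_card_of_injOn (fun p => (p.2 - p.1, p.2 + p.1)) ?_ ?_
        · intro p hp
          simp only [Finset.coe_filter, Set.mem_ofPred_eq] at hp
          simp only [Finset.coe_product, Set.mem_prod, Finset.mem_coe, Nat.mem_divisors]
          rw [← hp.2]
          have hne : f p ≠ 0 := by rw [hp.2]; omega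
          exact ⟨⟨⟨k p.1 * (p.2 + p.1), by simp only [hf]; ring⟩, hne⟩,
            ⟨⟨k p.1 * (p.2 - p.1), by simp only [hf]; ring⟩, hne⟩⟩
        · intro p hp p' hp' h
          simp only [Finset.coe_filter, Set.mem_ofPred_eq] at hp hp'
          have g1 := (hmemP p hp.1).2.2.1
          have g2 := (hmemP p' hp'.1).2.2.1
          simp only [Prod.mk.injEq] at h
          exact Prod.ext (by omega) (by omega)
      rw [Finset.card_product] at h2
      have h3 := hτ n hn1 hn2
      calc ((P.filter (fun p => f p = n)).card : ℝ)
          ≤ ((n.divisors.card * n.divisors.card : ℕ) : ℝ) := by exact_mod_cast h2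
        _ = (n.divisors.card : ℝ) ^ 2 := by push_cast; ring
        _ ≤ τ ^ 2 := by gcongr
    have h2 := card_near_int_le hq haq (δ := 2 * Z) (by positivity) M (s := P.image f)
      (fun n hn => by
        obtain ⟨p, hp, rfl⟩ := Finset.mem_image.1 hn
        exact hfM p hp)
      (fun n hn => by
        obtain ⟨p, hp, rfl⟩ := Finset.mem_image.1 hn
        obtain ⟨h1, h2, h3, h4⟩ := hmemP p hp
        obtain ⟨z1, hz1⟩ := (hB _ h1).2.2.2.2
        obtain ⟨z2, hz2⟩ := (hB _ h2).2.2.2.2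
        refine ⟨z2 - z1, ?_⟩
        rw [hfc p hp]
        rw [← h4] at hz2
        have : (k p.1 : ℝ) * ((p.2 : ℝ) ^ 2 - (p.1 : ℝ) ^ 2) * (a / q) - ((z2 - z1 : ℤ) : ℝ)
            = ((k p.1 : ℝ) * ((p.2 : ℝ) ^ 2 * (a / q)) - z2)
              - ((k p.1 : ℝ) * ((p.1 : ℝ) ^ 2 * (a / q)) - z1) := by push_cast; ring
        rw [this]
        refine (abs_sub _ _).trans ?_
        linarith)
    refine h1.trans ?_
    gcongr
    refine h2.trans ?_
    rw [show 2 * (q : ℝ) * (2 * Z) = 4 * q * Z by ring]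
    gcongr
  have hcs := card_sq_le_mul_card_pairs (B := B) (k := k) (Q := ⌊Q⌋₊)
    (fun w hw => ⟨(hB w hw).2.2.1, Nat.le_floor (hB w hw).2.2.2.1⟩)
  have hQ' : (⌊Q⌋₊ : ℝ) ≤ Q := Nat.floor_le (by linarith)
  calc (B.card : ℝ) ^ 2 ≤ ⌊Q⌋₊ * (B.card + 2 * P.card) := by exact_mod_cast hcs
    _ ≤ Q * (B.card + 2 * P.card) := by gcongr
    _ ≤ _ := by gcongr

/-- For $0<n<q$ coprimality makes $na/q$ a non-integer, hence at least $1/q$ from every integer. -/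
theorem lt_or_of_near_int {a : ℤ} {q : ℕ} (hq : 0 < q) (haq : IsCoprime a (q : ℤ)) {n : ℕ}
    (hn : 0 < n) (hnq : n < q) {z : ℤ} {Z : ℝ} (hz : |(n : ℝ) * (a / q) - z| ≤ Z) :
    1 ≤ q * Z := by
  have hq' : (0 : ℝ) < q := by exact_mod_cast hq
  have hne : (n : ℤ) * a - z * q ≠ 0 := by
    intro h
    have h1 : (q : ℤ) ∣ (n : ℤ) * a := ⟨z, by linear_combination h⟩
    have h2 := Nat.le_of_dvd hn (Int.natCast_dvd_natCast.1 (haq.symm.dvd_of_dvd_mul_right h1))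
    omega
  have h3 : (1 : ℝ) ≤ |(((n : ℤ) * a - z * q : ℤ) : ℝ)| := by
    exact_mod_cast Int.one_le_abs hne
  have h4 : (((n : ℤ) * a - z * q : ℤ) : ℝ) = q * ((n : ℝ) * (a / q) - z) := by
    push_cast; field_simp
  rw [h4, abs_mul, Nat.abs_cast] at h3
  exact h3.trans (by gcongr)

/-- The bound of `card_sq_le_of_near_int` in the range of parameters in which it is used. -/
theorem card_le_of_near_int {a : ℤ} {q : ℕ} (hq : 0 < q) (haq : IsCoprime a (q : ℤ))
    {W Q Z τ Λ : ℝ} (hW : 1 ≤ W) (hQ : 1 ≤ Q) (hZ : 0 ≤ Z) (hΛ : 0 < Λ) (hτ1 : 1 ≤ τ)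
    {B : Finset ℕ} {k : ℕ → ℕ}
    (hB : ∀ w ∈ B, W < w ∧ (w : ℝ) ≤ 2 * W ∧ 0 < k w ∧ (k w : ℝ) ≤ Q ∧
      ∃ z : ℤ, |(k w : ℝ) * ((w : ℝ) ^ 2 * (a / q)) - z| ≤ Z)
    (hτ : ∀ n : ℕ, 0 < n → (n : ℝ) ≤ 4 * Q * W ^ 2 → (n.divisors.card : ℝ) ≤ τ)
    (hqZ : q * Z ≤ 4 * Q * W ^ 2 / q) (h1 : 16 * (Q * Λ) ^ 2 ≤ q)
    (h2 : 28 * τ * Q * W * Λ ≤ q) :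
    (B.card : ℝ) ≤ 2 * √Q * W / Λ := by
  have hq' : (0 : ℝ) < q := by exact_mod_cast hq
  rcases B.eq_empty_or_nonempty with rfl | ⟨w, hw⟩
  · simp; positivity
  set R := 4 * Q * W ^ 2 / q with hR
  -- If $R<1$, every $k(w)w^2$ is below $q$, so a single $w$ would force $qZ\ge1$, against $qZ\le
  -- R$.
  have hR1 : 1 ≤ R := by
    by_contra! hlt
    obtain ⟨g1, g2, g3, g4, z, g5⟩ := hB w hw
    have hw0 : (0 : ℝ) < w := by linarith
    have hw0' : 0 < w := by exact_mod_cast hw0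
    have hn : ((k w * w ^ 2 : ℕ) : ℝ) < q := by
      have h3 : 4 * Q * W ^ 2 < q := by rwa [hR, div_lt_one hq'] at hlt
      refine lt_of_le_of_lt ?_ h3
      push_cast
      calc (k w : ℝ) * (w : ℝ) ^ 2 ≤ Q * (2 * W) ^ 2 := by gcongr
        _ = _ := by ring
    have := lt_or_of_near_int hq haq (n := k w * w ^ 2) (by positivity) (by exact_mod_cast hn)
      (z := z) (Z := Z) (by push_cast; rw [mul_assoc]; exact g5)
    linarith
  have hsq := card_sq_le_of_near_int hq haq hW hQ hZ hB hτ
  rw [← hR] at hsq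
  set D : ℝ := (B.card : ℝ) with hD
  have hD0 : 0 ≤ D := by positivity
  have hQ0 : 0 < √Q := Real.sqrt_pos.2 (by linarith)
  have hQQ : √Q * √Q = Q := Real.mul_self_sqrt (by linarith)
  have hsq2 : D ^ 2 ≤ Q * (D + 20 * (τ * R) ^ 2) := by
    refine hsq.trans ?_
    have : (R + 1) * (4 * q * Z + 1) ≤ (2 * R) * (5 * R) := by
      apply mul_le_mul (by linarith) (by linarith) (by positivity) (by linarith)
    have h4 : τ ^ 2 * ((R + 1) * (4 * q * Z + 1)) ≤ τ ^ 2 * ((2 * R) * (5 * R)) := by gcongr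
    have h6 : τ ^ 2 * ((2 * R) * (5 * R)) = 10 * (τ * R) ^ 2 := by ring
    exact mul_le_mul_of_nonneg_left (by linarith) (by linarith)
  -- Either the diagonal term or the pair term dominates. The first case is settled by `h1` with
  -- $q\le 4QW^2$, the second by `h2`.
  have hD2 : D ≤ 2 * Q ∨ D ≤ 7 * τ * √Q * R := by
    by_contra! hcon
    obtain ⟨c1, c2⟩ := hcon
    have c3 : (7 * τ * √Q * R) ^ 2 < D ^ 2 := by
      apply pow_lt_pow_left₀ c2 (by positivity) two_ne_zero
    have c4 : (7 * τ * √Q * R) ^ 2 = 49 * (Q * (τ * R) ^ 2) := by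
      calc (7 * τ * √Q * R) ^ 2 = 49 * ((√Q * √Q) * (τ * R) ^ 2) := by ring
        _ = _ := by rw [hQQ]
    have c5 : 2 * Q * D < D * D := by
      apply mul_lt_mul_of_pos_right c1
      linarith
    have c6 : 0 ≤ Q * (τ * R) ^ 2 := by positivity
    nlinarith
  rw [le_div_iff₀ hΛ]
  rcases hD2 with h | h
  · have hW2 : (4 * Q * Λ) ^ 2 ≤ (2 * √Q * W) ^ 2 := by
      have h3 : (q : ℝ) ≤ 4 * Q * W ^ 2 := by rwa [hR, one_le_div hq'] at hR1
      calc (4 * Q * Λ) ^ 2 = 16 * (Q * Λ) ^ 2 := by ring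
        _ ≤ 4 * Q * W ^ 2 := h1.trans h3
        _ = 4 * (√Q * √Q) * W ^ 2 := by rw [hQQ]
        _ = _ := by ring
    have h3 := abs_le_of_sq_le_sq hW2 (by positivity)
    have h4 : 4 * Q * Λ ≤ 2 * √Q * W := (le_abs_self _).trans h3
    calc D * Λ ≤ 2 * Q * Λ := by gcongr
      _ ≤ 4 * Q * Λ := by nlinarith
      _ ≤ _ := h4
  · calc D * Λ ≤ 7 * τ * √Q * R * Λ := by gcongr
      _ = (28 * τ * Q * W * Λ) * (√Q * W) / q := by rw [hR]; ring
      _ ≤ q * (√Q * W) / q := by gcongr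
      _ = √Q * W := by field_simp
      _ ≤ 2 * √Q * W := by nlinarith [mul_pos hQ0 (by linarith : (0 : ℝ) < W)]

theorem card_dyadic_le {Y : ℝ} (hY : 1 ≤ Y) : ((dyadic Y).card : ℝ) ≤ 2 * Y := by
  have h1 : (dyadic Y).card ≤ ⌊2 * Y⌋₊ := by rw [dyadic, Nat.card_Ioc]; omega
  calc ((dyadic Y).card : ℝ) ≤ ⌊2 * Y⌋₊ := by exact_mod_cast h1
    _ ≤ 2 * Y := Nat.floor_le (by linarith)

/-! ### Counting the pairs (v, w) -/

/-- The number of pairs `(v, w)` for which `(vw)² a / q` has a good rational approximation with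
small denominator. -/
theorem card_good_approx_le {a : ℤ} {q : ℕ} (hq : 0 < q) (haq : IsCoprime a (q : ℤ))
    {V W Y Z E Λ τ X : ℝ} (hV : 1 ≤ V) (hW : 1 ≤ W) (hY : 1 ≤ Y) (hZ : 0 ≤ Z) (hE : 0 < E)
    (hΛ : 0 < Λ) {J : ℕ} (hJ : E ≤ 2 ^ J)
    (hτ : ∀ n : ℕ, 0 < n → (n : ℝ) ≤ X → (n.divisors.card : ℝ) ≤ τ)
    (hX1 : 8 * Y * V ^ 2 ≤ X) (hX2 : 4 * (Y * (2 * E)) * W ^ 2 ≤ X)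
    (hqZ : (q : ℝ) ^ 2 * Z ≤ 4 * Y * (V * W) ^ 2)
    (h1 : 16 * (Y * (2 * E) * Λ) ^ 2 ≤ q) (h2 : 28 * τ * (Y * (2 * E)) * W * Λ ≤ q)
    {G : Finset (ℕ × ℕ)} {t : ℕ × ℕ → ℕ} {u : ℕ × ℕ → ℤ}
    (hG : ∀ p ∈ G, p.1 ∈ dyadic V ∧ p.2 ∈ dyadic W ∧ 0 < t p ∧ (t p : ℝ) ≤ Y ∧
      IsCoprime (u p) (t p : ℤ) ∧
      |(t p : ℝ) * (((p.1 : ℝ) * p.2) ^ 2 * (a / q)) - u p| ≤ Z) :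
    (G.card : ℝ) ≤ 2 * W * (72 * Y * V ^ 2 * Z * τ) +
      τ * (2 * V) * (2 * W / √E + 2 * J * (2 * √Y * W / Λ)) := by
  classical
  have hq' : (0 : ℝ) < q := by exact_mod_cast hq
  have hτ1 : 1 ≤ τ := by
    have := hτ 1 one_pos (le_trans (by push_cast; nlinarith [one_le_pow₀ hV (n := 2)]) hX1)
    simpa using this
  set K := ⌊4 * Y * V ^ 2⌋₊ with hKdef
  have hYV : 1 ≤ Y * V ^ 2 := one_le_mul_of_one_le_of_one_le hY (one_le_pow₀ hV)
  have hK : 0 < K := Nat.floor_pos.2 (by linarith)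
  have hK' : (K : ℝ) ≤ 4 * Y * V ^ 2 := Nat.floor_le (by positivity)
  set Gw : ℕ → Finset ℕ := fun w => (dyadic V).filter (fun v => (v, w) ∈ G) with hGw
  have hsl : ∀ w ∈ dyadic W, ((Gw w).card : ℝ) ≤ 18 * K * Z * τ ∨ ∃ (k e : ℕ) (z : ℤ), 0 < k ∧
      0 < e ∧ (k : ℝ) ≤ Y * e ∧ |k * ((w : ℝ) ^ 2 * (a / q)) - z| ≤ Z * e / V ^ 2 ∧
      ((Gw w).card : ℝ) ≤ τ * (2 * V / √e) := by
    intro w hw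
    refine card_slice_le (t := fun v => t (v, w)) (u := fun v => u (v, w)) hK (by linarith) hZ ?_
      (fun n hn hnK => hτ n hn ?_)
    · intro v hv
      simp only [hGw, Finset.mem_filter] at hv
      obtain ⟨-, -, g3, g4, g5, g6⟩ := hG _ hv.2
      obtain ⟨g7, g8⟩ := (mem_dyadic (by linarith) v).1 hv.1
      refine ⟨g7, g8, g3, g4, g5, ?_, ?_⟩
      · apply Nat.le_floor
        push_cast
        calc (t (v, w) : ℝ) * (v : ℝ) ^ 2 ≤ Y * (2 * V) ^ 2 := by gcongr
          _ = _ := by ring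
      · rw [show (t (v, w) : ℝ) * (v : ℝ) ^ 2 * ((w : ℝ) ^ 2 * (a / q))
          = (t (v, w) : ℝ) * (((v : ℝ) * w) ^ 2 * (a / q)) by ring]
        exact g6
    · have : (n : ℝ) ≤ 2 * K := by exact_mod_cast hnK
      linarith
  -- `B` collects the $w$ outside the first alternative; each has its own $k$ and $e$, and the slice
  -- over $w$ has size at most $2\tau V/\sqrt e$.
  set B := (dyadic W).filter (fun w => ¬ ((Gw w).card : ℝ) ≤ 18 * K * Z * τ) with hB
  have hBex : ∀ w ∈ B, ∃ (k e : ℕ) (z : ℤ), 0 < k ∧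
      0 < e ∧ (k : ℝ) ≤ Y * e ∧ |k * ((w : ℝ) ^ 2 * (a / q)) - z| ≤ Z * e / V ^ 2 ∧
      ((Gw w).card : ℝ) ≤ τ * (2 * V / √e) := by
    intro w hw
    rw [hB, Finset.mem_filter] at hw
    exact (hsl w hw.1).resolve_left hw.2
  choose! k e z hk0 he0 hke hkz hcard using hBex
  have hBW : (B.card : ℝ) ≤ 2 * W :=
    le_trans (by exact_mod_cast Finset.card_filter_le _ _) (card_dyadic_le hW)
  have hsum := sum_inv_sqrt_le B (fun w => (e w : ℝ))
    (fun w hw => by exact_mod_cast he0 w hw) (B := 2 * √Y * W / Λ) (by positivity) J hE hJ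
    (fun y hy hyE => by
      have hQ : Y * y ≤ Y * (2 * E) := by gcongr
      have hQ1 : 1 ≤ Y * y := one_le_mul_of_one_le_of_one_le hY hy
      have := card_le_of_near_int hq haq (Q := Y * y) (Z := Z * y / V ^ 2) (τ := τ) (Λ := Λ)
        (B := B.filter (fun w => (e w : ℝ) ≤ y)) (k := k) hW hQ1 (by positivity) hΛ hτ1
        (fun w hw => by
          rw [Finset.mem_filter] at hw
          have hwB := hw.1
          rw [hB, Finset.mem_filter] at hwB
          obtain ⟨g7, g8⟩ := (mem_dyadic (by linarith) w).1 hwB.1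
          refine ⟨g7, g8, hk0 w hw.1, (hke w hw.1).trans ?_, z w, (hkz w hw.1).trans ?_⟩
          · gcongr; exact hw.2
          · gcongr; exact hw.2)
        (fun n hn hnX => hτ n hn (hnX.trans (le_trans (by gcongr) hX2)))
        -- The condition $qZ'\le 4Q'W^2/q$ for $Z'=Zy/V^2$ and $Q'=Yy$: the factor $y$ cancels,
        -- leaving `hqZ`.
        (by
          rw [le_div_iff₀ hq', mul_div_assoc', div_mul_eq_mul_div, div_le_iff₀ (by positivity)]
          calc (q : ℝ) * (Z * y) * q = (q : ℝ) ^ 2 * Z * y := by ring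
            _ ≤ 4 * Y * (V * W) ^ 2 * y := by gcongr
            _ = _ := by ring)
        (le_trans (by gcongr) h1)
        (le_trans (by gcongr) h2)
      rw [Real.sqrt_mul (by linarith)] at this
      calc _ ≤ _ := this
        _ = _ := by ring)
  have hGcard : (G.card : ℝ) = ∑ w ∈ dyadic W, ((Gw w).card : ℝ) := by
    have h3 : G.card = ∑ w ∈ dyadic W, (G.filter (fun p => p.2 = w)).card :=
      Finset.card_eq_sum_card_fiberwise (fun p hp => (hG p hp).2.1)
    rw [h3]; push_cast
    refine Finset.sum_congr rfl fun w _ => ?_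
    congr 1
    refine Finset.card_bij (fun p _ => p.1) ?_ ?_ ?_
    · intro p hp
      rw [Finset.mem_filter] at hp
      simp only [hGw, Finset.mem_filter]
      refine ⟨(hG p hp.1).1, ?_⟩
      rw [← hp.2]; exact hp.1
    · intro p hp p' hp' h
      rw [Finset.mem_filter] at hp hp'
      exact Prod.ext h (by rw [hp.2, hp'.2])
    · intro v hv
      simp only [hGw, Finset.mem_filter] at hv
      exact ⟨(v, w), by simp [hv.2], rfl⟩
  rw [hGcard, ← Finset.sum_filter_not_add_sum_filter (dyadic W)
    (fun w => ¬ ((Gw w).card : ℝ) ≤ 18 * K * Z * τ)]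
  refine add_le_add ?_ ?_
  · have h3 : ∀ w ∈ (dyadic W).filter (fun w => ¬¬ ((Gw w).card : ℝ) ≤ 18 * K * Z * τ),
        ((Gw w).card : ℝ) ≤ 72 * Y * V ^ 2 * Z * τ := by
      intro w hw
      rw [Finset.mem_filter, not_not] at hw
      refine hw.2.trans ?_
      calc 18 * (K : ℝ) * Z * τ ≤ 18 * (4 * Y * V ^ 2) * Z * τ := by gcongr
        _ = _ := by ring
    refine (Finset.sum_le_sum h3).trans ?_
    rw [Finset.sum_const, nsmul_eq_mul]
    gcongr
    exact le_trans (by exact_mod_cast Finset.card_filter_le _ _) (card_dyadic_le hW)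
  · calc ∑ w ∈ B, ((Gw w).card : ℝ) ≤ ∑ w ∈ B, τ * (2 * V) * (1 / √(e w : ℝ)) :=
          Finset.sum_le_sum fun w hw => (hcard w hw).trans (le_of_eq (by ring))
      _ = τ * (2 * V) * ∑ w ∈ B, 1 / √(e w : ℝ) := by rw [Finset.mul_sum]
      _ ≤ τ * (2 * V) * (B.card / √E + 2 * J * (2 * √Y * W / Λ)) := by gcongr
      _ ≤ _ := by gcongr


/-! ### Choice of parameters and assembly -/

theorem T_eq_sum_product (a : ℤ) (q : ℕ) (β γ N L V W : ℝ) (S : ℕ → Set ℝ) :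
    T a q β γ N L V W S = ∑ p ∈ dyadic V ×ˢ dyadic W, ∑ l ∈ Finset.Icc 1 ⌊L⌋₊,
      ‖∑ n ∈ integersIn N S (p.1 * p.2),
        e ((l : ℝ) * g a q β γ (((p.1 * p.2 : ℕ) : ℝ) * n))‖ := by
  rw [T, Finset.sum_comm' (t' := dyadic V ×ˢ dyadic W) (s' := fun _ => Finset.Icc 1 ⌊L⌋₊)
    (s := Finset.Icc 1 ⌊L⌋₊) (t := fun _ => dyadic V ×ˢ dyadic W) (by simp) |>.symm]
  refine Finset.sum_congr rfl fun l _ => ?_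
  rw [Finset.sum_product]
  push_cast
  rfl

/-- The trivial bound. -/
theorem T_le_trivial {a : ℤ} {q : ℕ} {β γ N L V W : ℝ} {S : ℕ → Set ℝ} (hN : 1 ≤ N)
    (hL : 0 ≤ L) (hV : 1 ≤ V) (hW : 1 ≤ W) :
    T a q β γ N L V W S ≤ L * (4 * (V * W)) * N := by
  rw [T_eq_sum_product]
  have h1 : ∀ p ∈ dyadic V ×ˢ dyadic W, ∑ l ∈ Finset.Icc 1 ⌊L⌋₊,
      ‖∑ n ∈ integersIn N S (p.1 * p.2),
        e ((l : ℝ) * g a q β γ (((p.1 * p.2 : ℕ) : ℝ) * n))‖ ≤ L * N := by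
    intro p hp
    rw [Finset.mem_product, mem_dyadic (by linarith), mem_dyadic (by linarith)] at hp
    have hm : (1 : ℝ) ≤ ((p.1 * p.2 : ℕ) : ℝ) := by
      push_cast
      exact one_le_mul_of_one_le_of_one_le (by linarith) (by linarith)
    have h2 : ∀ l ∈ Finset.Icc 1 ⌊L⌋₊, ‖∑ n ∈ integersIn N S (p.1 * p.2),
        e ((l : ℝ) * g a q β γ (((p.1 * p.2 : ℕ) : ℝ) * n))‖ ≤ N := by
      intro l _
      refine (norm_sum_le _ _).trans ?_
      simp only [norm_e, Finset.sum_const, nsmul_eq_mul, mul_one]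
      have h3 : (integersIn N S (p.1 * p.2)).card ≤ ⌊N / ((p.1 * p.2 : ℕ) : ℝ)⌋₊ := by
        rw [← Nat.add_sub_cancel (n := ⌊N / ((p.1 * p.2 : ℕ) : ℝ)⌋₊) (m := 1), ← Nat.card_Icc]
        refine Finset.card_le_card fun n hn => ?_
        simp only [integersIn, Finset.mem_filter] at hn
        exact hn.1
      calc ((integersIn N S (p.1 * p.2)).card : ℝ) ≤ ⌊N / ((p.1 * p.2 : ℕ) : ℝ)⌋₊ := by
            exact_mod_cast h3
        _ ≤ N / ((p.1 * p.2 : ℕ) : ℝ) := Nat.floor_le (by positivity)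
        _ ≤ N := div_le_self (by linarith) hm
    refine (Finset.sum_le_sum h2).trans ?_
    rw [Finset.sum_const, nsmul_eq_mul, Nat.card_Icc, Nat.add_sub_cancel]
    gcongr
    exact Nat.floor_le hL
  refine (Finset.sum_le_sum h1).trans ?_
  rw [Finset.sum_const, nsmul_eq_mul, Finset.card_product]
  push_cast
  have h3 := card_dyadic_le hV
  have h4 := card_dyadic_le hW
  calc ((dyadic V).card : ℝ) * (dyadic W).card * (L * N) ≤ (2 * V) * (2 * W) * (L * N) := by gcongr
    _ = _ := by ring

/-- The number of pairs with good approximations, for parameters in the range of the theorem. -/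
theorem card_good_approx_le_of_params {a : ℤ} {q : ℕ} (hq : 0 < q) (haq : IsCoprime a (q : ℤ))
    {N L V W P y : ℝ} {J : ℕ} (hP : 1000 ≤ P) (hJ : N ≤ 2 ^ J) (hJP : (J : ℝ) + 2 ≤ P)
    (hτ : ∀ n : ℕ, 0 < n → (n : ℝ) ≤ N ^ 4 → (n.divisors.card : ℝ) ≤ P)
    (hL : 1 ≤ L) (hV : 1 ≤ V) (hW : 1 ≤ W)
    (h1 : P ^ 200 * L ^ 2 * (V * W) ≤ N) (h2 : P ^ 200 * L ^ 3 * (V ^ 3 * W ^ 2) ≤ N ^ 2)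
    (h3 : P ^ 200 * L ^ 6 ≤ q) (h4 : P ^ 200 * L ^ 3 * W ≤ q) (h5 : (q : ℝ) ^ 2 ≤ 4 * L * N ^ 2)
    (hy1 : 1 ≤ y) (hy2 : y ≤ 2 * (L ^ 2 * P ^ 30))
    {G : Finset (ℕ × ℕ)} {t : ℕ × ℕ → ℕ} {u : ℕ × ℕ → ℤ}
    (hG : ∀ p ∈ G, p.1 ∈ dyadic V ∧ p.2 ∈ dyadic W ∧ 0 < t p ∧ (t p : ℝ) ≤ y ∧
      IsCoprime (u p) (t p : ℤ) ∧
      |(t p : ℝ) * (((p.1 : ℝ) * p.2) ^ 2 * (a / q)) - u p| ≤ y / (L * (N / (V * W)) ^ 2)) :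
    (G.card : ℝ) ≤ V * W / (L * P ^ 15) * √y := by
  have hP0 : (0 : ℝ) < P := by linarith
  have hP1 : (1 : ℝ) ≤ P := by linarith
  have hVW : 1 ≤ V * W := one_le_mul_of_one_le_of_one_le hV hW
  have hL2 : 1 ≤ L ^ 2 := one_le_pow₀ hL
  have hbig : ∀ k : ℕ, k ≤ 200 → P ^ k * L ^ 2 * (V * W) ≤ N := fun k hk => by
    refine le_trans ?_ h1
    gcongr
  have hN1 : 1000 ≤ N := by
    have := hbig 1 (by norm_num)
    have h6 : P ≤ P ^ 1 * L ^ 2 * (V * W) := by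
      rw [pow_one]
      have : P * 1 ≤ P * L ^ 2 := by gcongr
      nlinarith
    linarith
  have hN0 : 0 < N := by linarith
  have hLP : ∀ k : ℕ, k ≤ 200 → P ^ k * L ^ 2 ≤ N := fun k hk => by
    refine le_trans ?_ (hbig k hk)
    exact le_mul_of_one_le_right (by positivity) hVW
  have hVN : V ≤ N := by
    have h6 := hbig 0 (by norm_num)
    rw [pow_zero, one_mul] at h6
    nlinarith
  have hWN : W ≤ N := by
    have h6 := hbig 0 (by norm_num)
    rw [pow_zero, one_mul] at h6
    nlinarith
  have hyN : y ≤ N := by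
    refine hy2.trans (le_trans ?_ (hLP 31 (by norm_num)))
    have : 0 ≤ L ^ 2 * P ^ 30 := by positivity
    calc 2 * (L ^ 2 * P ^ 30) ≤ P * (L ^ 2 * P ^ 30) := by gcongr; linarith
      _ = _ := by ring
  have hy0 : 0 < y := by linarith
  -- With this `E` and $\Lambda=LP^{20}$, both $1/\sqrt E$ and $\sqrt y/\Lambda$ equal $\sqrt
  -- y/(LP^{20})$; the five spare powers of $P$ absorb $\tau$, $J$ and constants. Also $yE$ is then
  -- independent of $y$.
  set E := L ^ 2 * P ^ 40 / y with hE
  have hyE : y * E = L ^ 2 * P ^ 40 := by rw [hE]; field_simp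
  have hE0 : 0 < E := by positivity
  have hEN : E ≤ N := by
    refine le_trans (div_le_self (by positivity) hy1) ?_
    rw [mul_comm]; exact hLP 40 (by norm_num)
  set D := L * (N / (V * W)) ^ 2 with hD
  have hD0 : 0 < D := by positivity
  have key := card_good_approx_le hq haq (Y := y) (Z := y / D) (E := E) (Λ := L * P ^ 20) (τ := P)
    (X := N ^ 4) (J := J) hV hW hy1 (by positivity) hE0 (by positivity) (hEN.trans hJ) hτ
    (by
      calc 8 * y * V ^ 2 ≤ N * N * N ^ 2 := by gcongr; linarith
        _ = _ := by ring)
    (by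
      calc 4 * (y * (2 * E)) * W ^ 2 = 8 * (P ^ 40 * L ^ 2) * W ^ 2 := by
            rw [show 4 * (y * (2 * E)) = 8 * (y * E) by ring, hyE]; ring
        _ ≤ N * N * N ^ 2 := by
            gcongr
            · linarith
            · exact hLP 40 (by norm_num)
        _ = _ := by ring)
    (by
      rw [mul_div_assoc', div_le_iff₀ hD0, hD]
      calc (q : ℝ) ^ 2 * y ≤ 4 * L * N ^ 2 * y := by gcongr
        _ = _ := by field_simp)
    (by
      rw [show 16 * (y * (2 * E) * (L * P ^ 20)) ^ 2 = 64 * ((y * E) * (L * P ^ 20)) ^ 2 by ring, hyE]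
      refine le_trans ?_ h3
      calc 64 * ((L ^ 2 * P ^ 40) * (L * P ^ 20)) ^ 2 = 64 * (P ^ 120 * L ^ 6) := by ring
        _ ≤ P ^ 80 * (P ^ 120 * L ^ 6) := by
            gcongr
            calc (64 : ℝ) ≤ P := by linarith
              _ ≤ P ^ 80 := le_self_pow₀ hP1 (by norm_num)
        _ = _ := by ring)
    (by
      rw [show 28 * P * (y * (2 * E)) * W * (L * P ^ 20) = 56 * P * (y * E) * W * (L * P ^ 20) by ring,
        hyE]
      refine le_trans ?_ h4
      calc 56 * P * (L ^ 2 * P ^ 40) * W * (L * P ^ 20) = 56 * (P ^ 61 * L ^ 3 * W) := by ring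
        _ ≤ P ^ 139 * (P ^ 61 * L ^ 3 * W) := by
            gcongr
            calc (56 : ℝ) ≤ P := by linarith
              _ ≤ P ^ 139 := le_self_pow₀ hP1 (by norm_num)
        _ = _ := by ring)
    hG
  refine key.trans ?_
  set B := V * W / (L * P ^ 15) * √y with hB
  have hsy0 : 0 < √y := Real.sqrt_pos.2 hy0
  have hsy : √y * √y = y := Real.mul_self_sqrt hy0.le
  have hB0 : 0 ≤ B := by positivity
  have hsy2 : √y ≤ 2 * (L * P ^ 15) := by
    rw [Real.sqrt_le_left (by positivity)]
    refine hy2.trans ?_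
    have : 0 ≤ L ^ 2 * P ^ 30 := by positivity
    calc 2 * (L ^ 2 * P ^ 30) ≤ 4 * (L ^ 2 * P ^ 30) := by linarith
      _ = _ := by ring
  have t1 : 2 * W * (72 * y * V ^ 2 * (y / D) * P) ≤ B / 3 := by
    have e1 : 2 * W * (72 * y * V ^ 2 * (y / D) * P)
        = (144 * P * (y * √y) * (V ^ 3 * W ^ 2)) * (V * W * √y / (L * N ^ 2)) := by
      rw [hD]
      field_simp
      rw [show √y ^ 2 = y by rw [sq, hsy]]
      ring
    have e2 : 432 * P ^ 16 * (y * √y) * (V ^ 3 * W ^ 2) ≤ N ^ 2 := by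
      refine le_trans ?_ h2
      calc 432 * P ^ 16 * (y * √y) * (V ^ 3 * W ^ 2)
          ≤ 432 * P ^ 16 * ((2 * (L ^ 2 * P ^ 30)) * (2 * (L * P ^ 15))) * (V ^ 3 * W ^ 2) := by gcongr
        _ = 1728 * (P ^ 61 * L ^ 3 * (V ^ 3 * W ^ 2)) := by ring
        _ ≤ P ^ 139 * (P ^ 61 * L ^ 3 * (V ^ 3 * W ^ 2)) := by
            gcongr
            calc (1728 : ℝ) ≤ 1000 ^ 2 := by norm_num
              _ ≤ P ^ 2 := by gcongr
              _ ≤ P ^ 139 := pow_le_pow_right₀ hP1 (by norm_num)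
        _ = _ := by ring
    rw [e1]
    have e3 : 144 * P * (y * √y) * (V ^ 3 * W ^ 2) ≤ N ^ 2 / (3 * P ^ 15) := by
      rw [le_div_iff₀ (by positivity)]
      calc _ = 432 * P ^ 16 * (y * √y) * (V ^ 3 * W ^ 2) := by ring
        _ ≤ _ := e2
    calc _ ≤ N ^ 2 / (3 * P ^ 15) * (V * W * √y / (L * N ^ 2)) := by gcongr
      _ = B / 3 := by rw [hB]; field_simp
  have hsE : √E = L * P ^ 20 / √y := by
    rw [hE, Real.sqrt_div' _ hy0.le, show L ^ 2 * P ^ 40 = (L * P ^ 20) ^ 2 by ring,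
      Real.sqrt_sq (by positivity)]
  have hP4 : 12 / P ^ 4 ≤ 1 := by
    rw [div_le_one (by positivity)]
    calc (12 : ℝ) ≤ P := by linarith
      _ ≤ P ^ 4 := le_self_pow₀ hP1 (by norm_num)
  have t2 : P * (2 * V) * (2 * W / √E) ≤ B / 3 := by
    calc P * (2 * V) * (2 * W / √E) = (12 / P ^ 4) * (B / 3) := by
          rw [hsE, hB]; field_simp; norm_num
      _ ≤ 1 * (B / 3) := by gcongr
      _ = _ := one_mul _
  have hP3 : 24 / P ^ 3 ≤ 1 := by
    rw [div_le_one (by positivity)]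
    calc (24 : ℝ) ≤ P := by linarith
      _ ≤ P ^ 3 := le_self_pow₀ hP1 (by norm_num)
  have t3 : P * (2 * V) * (2 * J * (2 * √y * W / (L * P ^ 20))) ≤ B / 3 := by
    have hJ' : (J : ℝ) ≤ P := by linarith
    calc P * (2 * V) * (2 * J * (2 * √y * W / (L * P ^ 20)))
        ≤ P * (2 * V) * (2 * P * (2 * √y * W / (L * P ^ 20))) := by gcongr
      _ = (24 / P ^ 3) * (B / 3) := by rw [hB]; field_simp; norm_num
      _ ≤ 1 * (B / 3) := by gcongr
      _ = _ := one_mul _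
  rw [mul_add]
  linarith

theorem weyl_sqrt_identity (P L : ℝ) {H y : ℝ} (hH : 0 ≤ H) (hy : 0 < y) :
    L * (P ^ 4 * (L * H + L * H ^ 2 / y))
      = (P ^ 2 * (L * √H)) ^ 2 + (P ^ 2 * (L * H) * (1 / √y)) ^ 2 := by
  have h1 : √H ^ 2 = H := Real.sq_sqrt hH
  have h2 : (1 / √y) ^ 2 = 1 / y := by rw [div_pow, Real.sq_sqrt hy.le, one_pow]
  rw [mul_pow, mul_pow L, mul_pow _ (1 / √y), h1, h2]
  ring

theorem add_sq_le_sq_add {x y : ℝ} (hx : 0 ≤ x) (hy : 0 ≤ y) : x ^ 2 + y ^ 2 ≤ (x + y) ^ 2 := by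
  nlinarith [mul_nonneg hx hy]

theorem weyl_arith {P x d i : ℝ} (hP : 1000 ≤ P) (hx : 0 ≤ x) (hd : 0 ≤ d) (hi : i + 1 ≤ P) :
    2 * x + 2 * P * ((i + 1) * (36 * x + 4 * d)) ≤ P ^ 4 * (x + d) := by
  have hP0 : (0 : ℝ) < P := by linarith
  have h1 : 2 * P * ((i + 1) * (36 * x + 4 * d)) ≤ 2 * P * (P * (36 * x + 4 * d)) := by gcongr
  have h2 : 1000 ≤ P ^ 2 := by nlinarith
  calc _ ≤ 2 * x + 2 * P * (P * (36 * x + 4 * d)) := by linarith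
    _ = 2 * x + 72 * (P ^ 2 * x) + 8 * (P ^ 2 * d) := by ring
    _ ≤ 2 * (P ^ 2 * x) + 72 * (P ^ 2 * x) + 8 * (P ^ 2 * d) := by
        have : 1 * x ≤ P ^ 2 * x := by gcongr; linarith
        linarith
    _ ≤ 1000 * (P ^ 2 * (x + d)) := by
        have h3 : 0 ≤ P ^ 2 * x := by positivity
        have h4 : 0 ≤ P ^ 2 * d := by positivity
        rw [mul_add]; linarith
    _ ≤ P ^ 2 * (P ^ 2 * (x + d)) := by gcongr
    _ = _ := by ring

/-- `h1` controls the diagonal of Weyl's inequality, `h2` the slices with a large count, `h3` and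
`h4` the diagonal and pair terms in the count of $w$, and `h5` makes the approximation error
$y/(LH^2)$ small enough relative to $q$. -/
theorem T_le_of_params {a : ℤ} {q : ℕ} (hq : 0 < q) (haq : IsCoprime a (q : ℤ))
    {β γ N L V W P : ℝ} {S : ℕ → Set ℝ} (hS : IsSubintervalFamily N S)
    {J : ℕ} (hP : 1000 ≤ P) (hJ : N ≤ 2 ^ J) (hJP : (J : ℝ) + 2 ≤ P)
    (hτ : ∀ n : ℕ, 0 < n → (n : ℝ) ≤ N ^ 4 → (n.divisors.card : ℝ) ≤ P)
    (hL : 1 ≤ L) (hV : 1 ≤ V) (hW : 1 ≤ W)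
    (h1 : P ^ 200 * L ^ 2 * (V * W) ≤ N) (h2 : P ^ 200 * L ^ 3 * (V ^ 3 * W ^ 2) ≤ N ^ 2)
    (h3 : P ^ 200 * L ^ 6 ≤ q) (h4 : P ^ 200 * L ^ 3 * W ≤ q) (h5 : (q : ℝ) ^ 2 ≤ 4 * L * N ^ 2) :
    T a q β γ N L V W S ≤ N / P ^ 10 := by
  have hP0 : (0 : ℝ) < P := by linarith
  have hP1 : (1 : ℝ) ≤ P := by linarith
  have hVW : 1 ≤ V * W := one_le_mul_of_one_le_of_one_le hV hW
  have hL2 : 1 ≤ L ^ 2 := one_le_pow₀ hL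
  have hbig : ∀ k : ℕ, k ≤ 200 → P ^ k * L ^ 2 * (V * W) ≤ N := fun k hk => by
    refine le_trans ?_ h1
    gcongr
  have hLP : ∀ k : ℕ, k ≤ 200 → P ^ k * L ^ 2 ≤ N := fun k hk => by
    refine le_trans ?_ (hbig k hk)
    exact le_mul_of_one_le_right (by positivity) hVW
  have hN1 : 1000 ≤ N := by
    refine le_trans ?_ (hLP 1 (by norm_num))
    rw [pow_one]; nlinarith
  have hN0 : 0 < N := by linarith
  have hLN : L ≤ N := by
    have := hLP 0 (by norm_num)
    rw [pow_zero, one_mul] at this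
    nlinarith
  have hVWN : V * W ≤ N := by
    have := hbig 0 (by norm_num)
    rw [pow_zero, one_mul] at this
    nlinarith
  set H := N / (V * W) with hH
  have hVW0 : 0 < V * W := by linarith
  have hH1 : 1 ≤ H := by rwa [hH, one_le_div hVW0]
  have hHN : H ≤ N := div_le_self hN0.le hVW
  have hHVW : H * (V * W) = N := by rw [hH]; field_simp
  obtain ⟨i, hi1, hi2⟩ := exists_nat_pow_near hH1 one_lt_two
  have hiJ : i ≤ J := by
    have : (2 : ℝ) ^ i ≤ 2 ^ J := by linarith
    exact (pow_le_pow_iff_right₀ one_lt_two).1 this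
  have hiP : ((i + 1 : ℕ) : ℝ) + 1 ≤ P := by
    have : (i : ℝ) ≤ J := by exact_mod_cast hiJ
    push_cast; linarith
  set K := 2 * ⌊L⌋₊ * ⌊H⌋₊ with hK
  have hL0 : 0 < ⌊L⌋₊ := Nat.floor_pos.2 hL
  have hH0 : 0 < ⌊H⌋₊ := Nat.floor_pos.2 hH1
  have hKpos : 0 < K := by rw [hK]; positivity
  have hKN : (K : ℝ) ≤ N ^ 4 := by
    rw [hK]; push_cast
    have g1 : (⌊L⌋₊ : ℝ) ≤ N := (Nat.floor_le (by linarith)).trans hLN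
    have g2 : (⌊H⌋₊ : ℝ) ≤ N := (Nat.floor_le (by linarith)).trans hHN
    calc (2 : ℝ) * ⌊L⌋₊ * ⌊H⌋₊ ≤ N * N * N := by gcongr; linarith
      _ = N ^ 3 := by ring
      _ ≤ N ^ 4 := pow_le_pow_right₀ (by linarith) (by norm_num)
  have happ : ∀ p : ℕ × ℕ, ∃ (t : ℕ) (u : ℤ), 0 < t ∧ IsCoprime u (t : ℤ) ∧ t ≤ 2 * K ∧
      |(t : ℝ) * (((p.1 * p.2 : ℕ) : ℝ) ^ 2 * (a / q)) - u| ≤ 1 / (2 * K) := by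
    intro p
    obtain ⟨t, u, g1, g2, g3, g4⟩ := exists_coprime_approx
      (((p.1 * p.2 : ℕ) : ℝ) ^ 2 * (a / q)) (n := 2 * K) (by omega)
    exact ⟨t, u, g1, g2, g3, by push_cast at g4 ⊢; exact g4⟩
  choose t u ht hut htK hβ using happ
  set D := L * H ^ 2 with hD
  have hD0 : 0 < D := by positivity
  set Y : ℕ × ℕ → ℝ := fun p =>
    max (t p : ℝ) (|(t p : ℝ) * (((p.1 * p.2 : ℕ) : ℝ) ^ 2 * (a / q)) - u p| * D) with hY
  have hY1 : ∀ p, 1 ≤ Y p := fun p => le_max_of_le_left (by exact_mod_cast ht p)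
  set s := dyadic V ×ˢ dyadic W with hs
  have hscard : (s.card : ℝ) ≤ 4 * (V * W) := by
    rw [hs, Finset.card_product]
    push_cast
    have g3 := card_dyadic_le hV
    have g4 := card_dyadic_le hW
    calc ((dyadic V).card : ℝ) * (dyadic W).card ≤ (2 * V) * (2 * W) := by gcongr
      _ = _ := by ring
  have hF : ∀ p ∈ s, ∑ l ∈ Finset.Icc 1 ⌊L⌋₊, ‖∑ n ∈ integersIn N S (p.1 * p.2),
      e ((l : ℝ) * g a q β γ (((p.1 * p.2 : ℕ) : ℝ) * n))‖
      ≤ P ^ 2 * (L * √H) + P ^ 2 * (L * H) * (1 / √(Y p)) := by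
    intro p hp
    rw [hs, Finset.mem_product, mem_dyadic (by linarith), mem_dyadic (by linarith)] at hp
    have hmVW : V * W ≤ ((p.1 * p.2 : ℕ) : ℝ) := by
      push_cast
      exact mul_le_mul hp.1.1.le hp.2.1.le (by linarith) (by linarith [hp.1.1])
    have hm : 0 < p.1 * p.2 := by
      have : (0 : ℝ) < ((p.1 * p.2 : ℕ) : ℝ) := by linarith
      exact_mod_cast this
    have hYp0 : 0 < Y p := by linarith [hY1 p]
    have hms := sum_normSq_le (H := H) (L := L) (τ := P) hN0.le hS hm (by rw [hH]; gcongr) hH1 hL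
      (I := i + 1) hi2.le (by rw [pow_succ]; linarith) a q β γ (ht p) (hut p) hK (htK p) (hβ p)
      (fun n hn hnK => hτ n hn (le_trans (by exact_mod_cast hnK) hKN))
    change _ ≤ 2 * L * H + 2 * P * ((((i + 1 : ℕ) : ℝ) + 1) * (36 * (L * H) + 4 * D / Y p)) at hms
    have hcs := sq_sum_le_card_mul_sum_sq (s := Finset.Icc 1 ⌊L⌋₊)
      (f := fun l : ℕ => ‖∑ n ∈ integersIn N S (p.1 * p.2),
        e ((l : ℝ) * g a q β γ (((p.1 * p.2 : ℕ) : ℝ) * n))‖)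
    rw [Nat.card_Icc, Nat.add_sub_cancel] at hcs
    refine le_of_sq_le_sq ?_ (by positivity)
    refine hcs.trans ?_
    have g1 : (⌊L⌋₊ : ℝ) ≤ L := Nat.floor_le (by linarith)
    have g2 := weyl_arith hP (by positivity : (0 : ℝ) ≤ L * H)
      (by positivity : (0 : ℝ) ≤ D / Y p) hiP
    rw [← mul_assoc 2 L H, mul_div_assoc' 4 D] at g2
    calc _ ≤ L * (P ^ 4 * (L * H + D / Y p)) := by
          gcongr
          exact hms.trans g2
      _ = (P ^ 2 * (L * √H)) ^ 2 + (P ^ 2 * (L * H) * (1 / √(Y p))) ^ 2 :=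
          weyl_sqrt_identity P L (by linarith) hYp0
      _ ≤ _ := add_sq_le_sq_add (by positivity) (by positivity)
  -- Cutting at $Y=L^2P^{30}$, a pair above the cut contributes at most $P^2LH/(LP^{15})$, a total
  -- of $O(N/P^{13})$.
  have hY0 : 0 < L ^ 2 * P ^ 30 := by positivity
  have hsum := sum_inv_sqrt_le s Y (fun p _ => hY1 p) (B := V * W / (L * P ^ 15)) (by positivity) J
    hY0 (le_trans (by rw [mul_comm]; exact hLP 30 (by norm_num)) hJ) (fun y hy1 hy2 => by
      refine card_good_approx_le_of_params hq haq (t := t) (u := u) hP hJ hJP hτ hL hV hW h1 h2 h3 h4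
        h5 hy1 hy2 (fun p hp => ?_)
      rw [Finset.mem_filter, hs, Finset.mem_product] at hp
      refine ⟨hp.1.1, hp.1.2, ht p, (le_max_left _ _).trans hp.2, hut p, ?_⟩
      rw [le_div_iff₀ hD0]
      have := (le_max_right _ _).trans hp.2
      push_cast at this
      exact this)
  rw [T_eq_sum_product]
  refine (Finset.sum_le_sum hF).trans ?_
  rw [Finset.sum_add_distrib, Finset.sum_const, nsmul_eq_mul, ← Finset.mul_sum]
  have hsqY : √(L ^ 2 * P ^ 30) = L * P ^ 15 := by
    rw [show L ^ 2 * P ^ 30 = (L * P ^ 15) ^ 2 by ring, Real.sqrt_sq (by positivity)]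
  rw [hsqY] at hsum
  have b1 : (s.card : ℝ) * (P ^ 2 * (L * √H)) ≤ 4 * N / P ^ 12 := by
    have c1 : P ^ 14 * L * (V * W) * √H ≤ N := by
      refine le_of_sq_le_sq ?_ hN0.le
      calc (P ^ 14 * L * (V * W) * √H) ^ 2 = P ^ 28 * L ^ 2 * (V * W) * ((V * W) * (√H * √H)) := by
            ring
        _ = P ^ 28 * L ^ 2 * (V * W) * N := by
            rw [Real.mul_self_sqrt (by linarith), mul_comm (V * W) H, hHVW]
        _ ≤ N * N := by gcongr; exact hbig 28 (by norm_num)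
        _ = _ := by ring
    rw [le_div_iff₀ (by positivity)]
    calc (s.card : ℝ) * (P ^ 2 * (L * √H)) * P ^ 12
        ≤ (4 * (V * W)) * (P ^ 2 * (L * √H)) * P ^ 12 := by gcongr
      _ = 4 * (P ^ 14 * L * (V * W) * √H) := by ring
      _ ≤ _ := by gcongr
  have b2 : P ^ 2 * (L * H) * ∑ p ∈ s, 1 / √(Y p) ≤ 4 * N / P ^ 12 := by
    have hJ' : (J : ℝ) ≤ P := by linarith
    calc P ^ 2 * (L * H) * ∑ p ∈ s, 1 / √(Y p)
        ≤ P ^ 2 * (L * H) * (4 * (V * W) / (L * P ^ 15) + 2 * P * (V * W / (L * P ^ 15))) := by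
          gcongr
          exact hsum.trans (by gcongr)
      _ = (H * (V * W)) * (4 + 2 * P) / P ^ 13 := by field_simp
      _ = N * (4 + 2 * P) / P ^ 13 := by rw [hHVW]
      _ ≤ N * (4 * P) / P ^ 13 := by gcongr; linarith
      _ = _ := by field_simp
  calc _ ≤ 4 * N / P ^ 12 + 4 * N / P ^ 12 := add_le_add b1 b2
    _ = 8 / P ^ 2 * (N / P ^ 10) := by field_simp; norm_num
    _ ≤ 1 * (N / P ^ 10) := by
        gcongr
        rw [div_le_one (by positivity)]; nlinarith
    _ = _ := one_mul _

/-! ### Large N and comparison of exponents -/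

/-- For large `N`, constants, logarithms and divisor functions are at most `N ^ η`. -/
theorem exists_threshold {η : ℝ} (hη : 0 < η) (A : ℝ) : ∃ N₀ : ℝ, 1 ≤ N₀ ∧ ∀ N : ℝ, N₀ ≤ N →
    A ≤ N ^ η ∧ 1000 ≤ N ^ η ∧ (∃ J : ℕ, N ≤ 2 ^ J ∧ (J : ℝ) + 2 ≤ N ^ η) ∧
    ∀ n : ℕ, 0 < n → (n : ℝ) ≤ N ^ 4 → (n.divisors.card : ℝ) ≤ N ^ η := by
  obtain ⟨C, hC, hdiv⟩ := exists_card_divisors_le (δ := η / 8) (by positivity)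
  have t1 := tendsto_rpow_atTop hη
  have t2 := tendsto_rpow_atTop (y := η / 2) (by positivity)
  have t3 := (isLittleO_log_rpow_atTop hη).bound (c := 1 / 10) (by norm_num)
  have hev := (t1.eventually_ge_atTop A).and ((t1.eventually_ge_atTop 1000).and
    ((t2.eventually_ge_atTop C).and (t3.and (Filter.eventually_ge_atTop 1))))
  obtain ⟨N₀, hN₀⟩ := Filter.eventually_atTop.1 hev
  refine ⟨max N₀ 1, le_max_right _ _, fun N hN => ?_⟩
  obtain ⟨g1, g2, g3, g4, g5⟩ := hN₀ N ((le_max_left _ _).trans hN)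
  have hN0 : 0 < N := by linarith
  refine ⟨g1, g2, ⟨⌈Real.logb 2 N⌉₊, ?_, ?_⟩, fun n hn hnN => ?_⟩
  · have h := Nat.le_ceil (Real.logb 2 N)
    calc N = (2 : ℝ) ^ Real.logb 2 N := (Real.rpow_logb two_pos (by norm_num) hN0).symm
      _ ≤ (2 : ℝ) ^ ((⌈Real.logb 2 N⌉₊ : ℕ) : ℝ) := Real.rpow_le_rpow_of_exponent_le one_le_two h
      _ = _ := Real.rpow_natCast _ _
  · have hlog : 0 ≤ Real.log N := Real.log_nonneg g5
    have h := Nat.ceil_lt_add_one (a := Real.logb 2 N)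
      (div_nonneg hlog (Real.log_nonneg one_le_two))
    have h2 : Real.logb 2 N ≤ 2 * Real.log N := by
      rw [Real.logb, div_le_iff₀ (Real.log_pos one_lt_two)]
      nlinarith [Real.log_two_gt_d9]
    rw [Real.norm_of_nonneg hlog, Real.norm_of_nonneg (by positivity)] at g4
    linarith
  · calc (n.divisors.card : ℝ) ≤ C * (n : ℝ) ^ (η / 8) := hdiv n hn
      _ ≤ N ^ (η / 2) * (N ^ 4) ^ (η / 8) := by gcongr
      _ = N ^ η := by
        rw [← Real.rpow_natCast, ← Real.rpow_mul hN0.le, ← Real.rpow_add hN0]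
        congr 1; push_cast; ring

end TypeI

theorem theorem2 :
    ∃ ε₀ : ℝ, 0 < ε₀ ∧ ∀ ε : ℝ, 0 < ε → ε < ε₀ → ∀ A : ℝ, 0 < A → ∃ C : ℝ, 0 < C ∧
      ∀ (ρ : ℝ), 1 / 6 < ρ → ρ < 2 / 11 →
      ∀ (a : ℤ) (q : ℕ), 0 < q → IsCoprime a (q : ℤ) →
      ∀ (β γ N : ℝ), 1 ≤ N →
      (2 * N ^ (ρ - ε / 2)) ^ (1 / 2 : ℝ) * N ≤ A * (q : ℝ) →
      (q : ℝ) ≤ A * ((2 * N ^ (ρ - ε / 2)) ^ (1 / 2 : ℝ) * N) →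
      ∀ (V W : ℝ), 1 ≤ V → 1 ≤ W →
      V ^ 3 * W ^ 2 ≤ A * N ^ (2 - 3 * ρ) →
      V * W ^ 3 ≤ A * N ^ (3 - 15 * ρ / 2) →
      V * W ≤ A * N ^ (2 - 8 * ρ) →
      ∀ (I : ℕ → Set ℝ), TypeI.IsSubintervalFamily N I →
      TypeI.T a q β γ N (N ^ (ρ - ε / 3)) V W I ≤ C * N ^ (1 - 10 * ε ^ 9) := by
  -- With $\varepsilon<\frac1{10}$ one has $\eta=\varepsilon^9\le 10^{-8}\varepsilon$, so every
  -- power of $P=N^\eta$ used below costs far less than $N^\varepsilon$.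
  refine ⟨1 / 10, by norm_num, fun ε hε hε0 A hA => ?_⟩
  set η := ε ^ 9 with hη
  have hη0 : 0 < η := by positivity
  have hηε : 10 ^ 8 * η ≤ ε := by
    have : ε ^ 8 ≤ (1 / 10) ^ 8 := by gcongr
    have h9 : η = ε ^ 8 * ε := by rw [hη]; ring
    rw [h9]; nlinarith
  obtain ⟨N₀, hN₀, hthr⟩ := TypeI.exists_threshold hη0 A
  -- The term $4AN_0^4$ pays for the trivial bound when $N<N_0$.
  refine ⟨1 + 4 * A * N₀ ^ 4, by positivity, ?_⟩
  intro ρ hρ1 hρ2 a q hq haq β γ N hN hq1 hq2 V W hV hW c1 c2 c3 S hS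
  have hN0 : 0 < N := by linarith
  have hL1 : 1 ≤ N ^ (ρ - ε / 3) := Real.one_le_rpow hN (by linarith)
  rcases lt_or_ge N N₀ with hlt | hge
  · refine (TypeI.T_le_trivial hN (by linarith) hV hW).trans ?_
    have d1 : N ^ (ρ - ε / 3) ≤ N := by
      conv_rhs => rw [← Real.rpow_one N]
      exact Real.rpow_le_rpow_of_exponent_le hN (by linarith)
    have d2 : N ^ (2 - 8 * ρ) ≤ N ^ 2 := by
      rw [← Real.rpow_natCast]
      exact Real.rpow_le_rpow_of_exponent_le hN (by push_cast; linarith)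
    have d3 : 1 ≤ N ^ (1 - 10 * η) := Real.one_le_rpow hN (by linarith)
    calc N ^ (ρ - ε / 3) * (4 * (V * W)) * N ≤ N * (4 * (A * N ^ 2)) * N := by
          have := c3.trans (mul_le_mul_of_nonneg_left d2 hA.le)
          gcongr
      _ = 4 * A * N ^ 4 := by ring
      _ ≤ 4 * A * N₀ ^ 4 := by gcongr
      _ ≤ (1 + 4 * A * N₀ ^ 4) * 1 := by linarith
      _ ≤ _ := by gcongr
  · obtain ⟨hAP, hP, ⟨J, hJ, hJP⟩, hτ⟩ := hthr N hge
    set P := N ^ η with hPdef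
    have hP0 : 0 < P := by positivity
    have hPk : ∀ k : ℕ, P ^ k = N ^ (k * η) := fun k => by
      rw [hPdef, ← Real.rpow_natCast, ← Real.rpow_mul hN0.le, mul_comm]
    have hLk : ∀ k : ℕ, (N ^ (ρ - ε / 3)) ^ k = N ^ (k * (ρ - ε / 3)) := fun k => by
      rw [← Real.rpow_natCast, ← Real.rpow_mul hN0.le, mul_comm]
    have hmono : ∀ {x y : ℝ}, x ≤ y → N ^ x ≤ N ^ y := fun h =>
      Real.rpow_le_rpow_of_exponent_le hN h
    have hroot : (2 * N ^ (ρ - ε / 2)) ^ (1 / 2 : ℝ) * N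
        = 2 ^ (1 / 2 : ℝ) * N ^ (1 + (ρ - ε / 2) / 2) := by
      rw [Real.mul_rpow (by norm_num) (by positivity), ← Real.rpow_mul hN0.le, mul_assoc]
      congr 1
      conv_lhs => rw [← Real.rpow_one N, ← Real.rpow_mul hN0.le]
      rw [← Real.rpow_add hN0]
      congr 1; ring
    rw [hroot] at hq1 hq2
    have h2a : (1 : ℝ) ≤ 2 ^ (1 / 2 : ℝ) := Real.one_le_rpow one_le_two (by norm_num)
    have h2b : ((2 : ℝ) ^ (1 / 2 : ℝ)) ^ 2 = 2 := by
      rw [← Real.rpow_natCast, ← Real.rpow_mul (by norm_num)]; norm_num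
    have hqlow : N ^ (1 + (ρ - ε / 2) / 2 - η) ≤ q := by
      rw [Real.rpow_sub hN0, div_le_iff₀ (by positivity)]
      calc N ^ (1 + (ρ - ε / 2) / 2) ≤ 2 ^ (1 / 2 : ℝ) * N ^ (1 + (ρ - ε / 2) / 2) :=
            le_mul_of_one_le_left (by positivity) h2a
        _ ≤ A * q := hq1
        _ ≤ P * q := by gcongr
        _ = _ := mul_comm _ _
    have hqup : (q : ℝ) ^ 2 ≤ 4 * N ^ (ρ - ε / 3) * N ^ 2 := by
      calc (q : ℝ) ^ 2 ≤ (P * (2 ^ (1 / 2 : ℝ) * N ^ (1 + (ρ - ε / 2) / 2))) ^ 2 := by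
            gcongr
            exact hq2.trans (by gcongr)
        _ = 2 * (P ^ 2 * (N ^ (1 + (ρ - ε / 2) / 2)) ^ 2) := by
            rw [mul_pow, mul_pow, h2b]; ring
        _ = 2 * N ^ (2 * η + (1 + (ρ - ε / 2) / 2) * 2) := by
            rw [hPk, ← Real.rpow_natCast (N ^ _), ← Real.rpow_mul hN0.le, ← Real.rpow_add hN0]
            norm_num
        -- The gap $\varepsilon/6$ between the exponents of $L$ and $L_1$ absorbs $P^2$.
        _ ≤ 4 * N ^ ((ρ - ε / 3) + 2) := by
            have : N ^ (2 * η + (1 + (ρ - ε / 2) / 2) * 2) ≤ N ^ ((ρ - ε / 3) + 2) :=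
              hmono (by linarith)
            have h0 : 0 < N ^ ((ρ - ε / 3) + 2) := by positivity
            linarith
        _ = _ := by
            rw [Real.rpow_add hN0, mul_assoc]
            norm_num
    have hW1 : W ≤ N ^ (η + (1 - 5 * ρ / 2)) := by
      refine le_of_pow_le_pow_left₀ (n := 3) (by norm_num) (by positivity) ?_
      calc W ^ 3 ≤ V * W ^ 3 := le_mul_of_one_le_left (by positivity) hV
        _ ≤ A * N ^ (3 - 15 * ρ / 2) := c2
        _ ≤ N ^ η * N ^ (3 - 15 * ρ / 2) := by gcongr
        _ = N ^ (η + (3 - 15 * ρ / 2)) := (Real.rpow_add hN0 _ _).symm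
        _ ≤ N ^ ((η + (1 - 5 * ρ / 2)) * (3 : ℕ)) := hmono (by push_cast; linarith)
        _ = _ := by rw [Real.rpow_mul hN0.le, Real.rpow_natCast]
    have main := TypeI.T_le_of_params (β := β) (γ := γ) hq haq hS hP hJ hJP hτ hL1 hV hW
      (by
        rw [hPk, hLk]
        calc _ ≤ N ^ (((200 : ℕ) : ℝ) * η) * N ^ (((2 : ℕ) : ℝ) * (ρ - ε / 3)) *
              (N ^ η * N ^ (2 - 8 * ρ)) := by
              refine mul_le_mul_of_nonneg_left ?_ (by positivity)
              exact c3.trans (mul_le_mul_of_nonneg_right hAP (by positivity))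
          _ = N ^ (((200 : ℕ) : ℝ) * η + ((2 : ℕ) : ℝ) * (ρ - ε / 3) + (η + (2 - 8 * ρ))) := by
              rw [Real.rpow_add hN0, Real.rpow_add hN0, Real.rpow_add hN0]
          -- Here $\rho>\frac16$ enters: $2\rho+(2-8\rho)<1$.
          _ ≤ N ^ (1 : ℝ) := hmono (by push_cast; linarith)
          _ = N := Real.rpow_one N)
      (by
        rw [hPk, hLk]
        calc _ ≤ N ^ (((200 : ℕ) : ℝ) * η) * N ^ (((3 : ℕ) : ℝ) * (ρ - ε / 3)) *
              (N ^ η * N ^ (2 - 3 * ρ)) := by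
              refine mul_le_mul_of_nonneg_left ?_ (by positivity)
              exact c1.trans (mul_le_mul_of_nonneg_right hAP (by positivity))
          _ = N ^ (((200 : ℕ) : ℝ) * η + ((3 : ℕ) : ℝ) * (ρ - ε / 3) + (η + (2 - 3 * ρ))) := by
              rw [Real.rpow_add hN0, Real.rpow_add hN0, Real.rpow_add hN0]
          -- The $\rho$ terms cancel exactly; the saving is the $\varepsilon$ from $L^3$.
          _ ≤ N ^ ((2 : ℕ) : ℝ) := hmono (by push_cast; linarith)
          _ = N ^ 2 := Real.rpow_natCast N 2)
      (by
        rw [hPk, hLk, ← Real.rpow_add hN0]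
        -- Here $\rho<\frac2{11}$ enters: $6\rho<1+\rho/2$.
        refine le_trans (hmono ?_) hqlow
        push_cast; linarith)
      (by
        rw [hPk, hLk]
        calc _ ≤ N ^ (((200 : ℕ) : ℝ) * η) * N ^ (((3 : ℕ) : ℝ) * (ρ - ε / 3)) *
              N ^ (η + (1 - 5 * ρ / 2)) := by gcongr
          _ = N ^ (((200 : ℕ) : ℝ) * η + ((3 : ℕ) : ℝ) * (ρ - ε / 3) + (η + (1 - 5 * ρ / 2))) := by
              rw [← Real.rpow_add hN0, ← Real.rpow_add hN0]
          -- Again $3\rho+1-\frac52\rho=1+\frac\rho2$ exactly. The saving is $\varepsilon$ from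
          -- $L^3$ against the $\varepsilon/4$ lost in $q$.
          _ ≤ _ := hmono (by push_cast; linarith)
          _ ≤ q := hqlow)
      hqup
    refine main.trans ?_
    have hfin : N / P ^ 10 = N ^ (1 - 10 * η) := by
      rw [hPk, Real.rpow_sub hN0, Real.rpow_one]
      norm_num
    rw [hfin]
    refine le_mul_of_one_le_left (by positivity) ?_
    have : 0 < 4 * A * N₀ ^ 4 := by positivity
    linarith
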